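/- Let $I=[a,b]$ with $-\infty<a<b<\infty$, let $1<p,q<\infty$ and $1/p'=1-1/p$, and let $u,v$ be positive functions on $I$ with $u\in L_{p'}(I)$ and $v\in L_q(I)$. For $t\in\mathbb{R}$ and $s\in\{p,q\}$ write $t_{(s)}=|t|^{s-1}\operatorname{sgn}(t)$, and put $$(Tf)(x)=v(x)\int_a^x f(t)u(t)\,dt,\qquad (T^*h)(x)=u(x)\int_x^b v(y)h(y)\,dy,\qquad x\in I.$$ A spectral triple is a triple $(g,f,\lambda)$ with $f\in L_p(I)$, $\|f\|_p=1$, $\lambda\in\mathbb{R}$, such that $g=Tf$ and $f_{(p)}=\lambda\,T^*(g_{(q)})$ on $I$. For $n\in\{0,1,2,\dots\}$ let $SP_n(T,p,q)$ be the set of all spectral triples $(g,f,\lambda)$ for which $g$ has exactly $n$ distinct zeros in the open interval $(a,b)$. Then $SP_n(T,p,q)\neq\emptyset$ for every $n\in\{0,1,2,\dots\}$. -/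

import Mathlib

open MeasureTheory

noncomputable section

namespace HardySystem

/-- The signed power `(t)_(p) = |t|^(p-1) sgn t`. -/
def signedPow (p t : ℝ) : ℝ := |t| ^ (p - 1) * Real.sign t

/-- The Hardy-type operator `(T f)(x) = v(x) ∫_a^x f(t) u(t) dt`. -/
def hardyOp (a : ℝ) (u v f : ℝ → ℝ) (x : ℝ) : ℝ :=
  v x * ∫ t in a..x, f t * u t

/-- The operator `(T* h)(x) = u(x) ∫_x^b v(y) h(y) dy`. -/
def hardyDual (b : ℝ) (u v h : ℝ → ℝ) (x : ℝ) : ℝ :=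
  u x * ∫ y in x..b, v y * h y

/-- `SP(T,p,q)`: the spectral triples `(g, f, λ)`, that is, `f ∈ L_p(I)` with `‖f‖_p = 1`,
`g = T f` and `f_(p) = λ T*(g_(q))` on `I = [a,b]`. -/
def SP (a b p q : ℝ) (u v : ℝ → ℝ) : Set ((ℝ → ℝ) × (ℝ → ℝ) × ℝ) :=
  {τ | MemLp τ.2.1 (ENNReal.ofReal p) (volume.restrict (Set.Icc a b)) ∧
    eLpNorm τ.2.1 (ENNReal.ofReal p) (volume.restrict (Set.Icc a b)) = 1 ∧
    (∀ x ∈ Set.Icc a b, τ.1 x = hardyOp a u v τ.2.1 x) ∧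
    (∀ x ∈ Set.Icc a b,
      signedPow p (τ.2.1 x) = τ.2.2 * hardyDual b u v (fun y => signedPow q (τ.1 y)) x)}

/-- `Z(g)`: the number (possibly infinite) of distinct zeros of `g` in the open interval. -/
def zeroCount (a b : ℝ) (g : ℝ → ℝ) : ℕ∞ := {x ∈ Set.Ioo a b | g x = 0}.encard

/-- `SP_n(T,p,q)`: the spectral triples `(g, f, λ)` with `Z(g) = n`. -/
def SPn (a b p q : ℝ) (u v : ℝ → ℝ) (n : ℕ) : Set ((ℝ → ℝ) × (ℝ → ℝ) × ℝ) :=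
  {τ ∈ SP a b p q u v | zeroCount a b τ.1 = n}

end HardySystem

end

/-
With `P = p'`, `U = u ^ P`, `V = v ^ q` and the signed power `φ_r(t) = t_(r)`, spectral triples
correspond to solutions with `f a = 0`, `g b = 0` of the planar system
`f' = c₁ φ_P(g) U`, `g' = -c₂ φ_q(f) V`: the function `F = φ_P(u g)` satisfies `T F = c₁⁻¹ v f` and
`φ_p(F) = u g = c₂ T*(φ_q(v f))`, and normalising `F` gives the triple.

Initial value problems for this system need not have unique solutions, so one cannot shoot
directly. For the splitting scheme that moves the coordinates alternately, the rotation angle of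
`(g, f)` depends continuously on the multiplier, and the intermediate value theorem yields discrete
solutions that wind through exactly `2n + 1` quadrants. The longest stay in a quadrant carries
masses bounded below; normalising in its middle bounds the multipliers, and monotonicity within
each quadrant turns this into bounds on the whole solution that do not depend on the subdivision.
By the Arzelà–Ascoli theorem a subsequence converges to a solution that winds through the same
quadrants, whose first component vanishes exactly `n` times inside the interval.
-/

namespace HardySystem

open Filter Topology
open scoped NNReal

/-! ### The signed power -/

theorem signedPow_neg (P t : ℝ) : signedPow P (-t) = -signedPow P t := by
  simp [signedPow, Real.sign_neg]

theorem signedPow_zero (P : ℝ) : signedPow P 0 = 0 := by simp [signedPow]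

theorem signedPow_of_pos (P : ℝ) {t : ℝ} (ht : 0 < t) : signedPow P t = t ^ (P - 1) := by
  rw [signedPow, abs_of_pos ht, Real.sign_of_pos ht, mul_one]

theorem signedPow_of_nonneg {P t : ℝ} (hP : 1 < P) (ht : 0 ≤ t) :
    signedPow P t = t ^ (P - 1) := by
  rcases ht.eq_or_lt with rfl | h
  · rw [signedPow_zero, Real.zero_rpow (by linarith)]
  · exact signedPow_of_pos P h

theorem signedPow_pos {P t : ℝ} (ht : 0 < t) : 0 < signedPow P t := by
  rw [signedPow_of_pos P ht]
  exact Real.rpow_pos_of_pos ht _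

theorem signedPow_nonneg {P t : ℝ} (ht : 0 ≤ t) : 0 ≤ signedPow P t := by
  rcases ht.eq_or_lt with rfl | h
  · rw [signedPow_zero]
  · exact (signedPow_pos h).le

theorem signedPow_mul_self (P t : ℝ) : signedPow P t * t = |t| ^ (P - 1) * |t| := by
  rcases lt_trichotomy t 0 with h | rfl | h
  · rw [signedPow, Real.sign_of_neg h, abs_of_neg h]
    ring
  · simp
  · rw [signedPow_of_pos P h, abs_of_pos h]

theorem signedPow_mul_self_nonneg (P t : ℝ) : 0 ≤ signedPow P t * t := by
  rw [signedPow_mul_self]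
  positivity

theorem signedPow_mul_self_pos {P t : ℝ} (ht : t ≠ 0) : 0 < signedPow P t * t := by
  rw [signedPow_mul_self]
  positivity

theorem signedPow_ne_zero {P t : ℝ} (ht : t ≠ 0) : signedPow P t ≠ 0 :=
  left_ne_zero_of_mul (signedPow_mul_self_pos ht).ne'

theorem signedPow_mul (P s t : ℝ) : signedPow P (s * t) = signedPow P s * signedPow P t := by
  have h : Real.sign (s * t) = Real.sign s * Real.sign t := by
    rcases lt_trichotomy s 0 with hs | rfl | hs <;> rcases lt_trichotomy t 0 with ht | rfl | ht <;>
      simp [*, Real.sign_of_pos, Real.sign_of_neg, mul_pos_of_neg_of_neg, mul_neg_of_neg_of_pos,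
        mul_neg_of_pos_of_neg]
  rw [signedPow, signedPow, signedPow, h, abs_mul, Real.mul_rpow (abs_nonneg _) (abs_nonneg _)]
  ring

theorem signedPow_neg_one_pow (P : ℝ) (k : ℕ) : signedPow P ((-1) ^ k) = (-1) ^ k := by
  have h1 : signedPow P 1 = 1 := by rw [signedPow_of_pos P one_pos, Real.one_rpow]
  rcases neg_one_pow_eq_or ℝ k with h | h <;> simp [h, signedPow_neg, h1]

theorem abs_signedPow (P t : ℝ) : |signedPow P t| = signedPow P |t| := by
  rcases le_total 0 t with h | h
  · rw [abs_of_nonneg h, abs_of_nonneg (signedPow_nonneg h)]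
  · have := signedPow_nonneg (P := P) (neg_nonneg.2 h)
    rw [abs_of_nonpos h, signedPow_neg, abs_of_nonpos]
    rwa [signedPow_neg, neg_nonneg] at this

theorem signedPow_le_signedPow {P s t : ℝ} (hP : 1 < P) (hs : 0 ≤ s) (h : s ≤ t) :
    signedPow P s ≤ signedPow P t := by
  rw [signedPow_of_nonneg hP hs, signedPow_of_nonneg hP (hs.trans h)]
  exact Real.rpow_le_rpow hs h (by linarith)

theorem continuous_signedPow {P : ℝ} (hP : 1 < P) : Continuous (signedPow P) := by
  have h : signedPow P = fun t => (max t 0) ^ (P - 1) - (max (-t) 0) ^ (P - 1) := by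
    have h0 : (0 : ℝ) ^ (P - 1) = 0 := Real.zero_rpow (by linarith)
    funext t
    rcases le_total 0 t with h | h
    · rw [signedPow_of_nonneg hP h, max_eq_left h, max_eq_right (by linarith), h0, sub_zero]
    · rw [max_eq_right h, max_eq_left (by linarith), h0, zero_sub,
        ← signedPow_of_nonneg hP (by linarith), signedPow_neg, neg_neg]
  rw [h]
  have hP' : 0 ≤ P - 1 := by linarith
  exact ((continuous_id.max continuous_const).rpow_const fun _ => Or.inr hP').sub
    ((continuous_id.neg.max continuous_const).rpow_const fun _ => Or.inr hP')

theorem signedPow_signedPow_conj {p q : ℝ} (h : p.HolderConjugate q) (t : ℝ) :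
    signedPow p (signedPow q t) = t := by
  have key : ∀ t : ℝ, 0 ≤ t → signedPow p (signedPow q t) = t := fun t ht => by
    rw [signedPow_of_nonneg h.symm.lt ht, signedPow_of_nonneg h.lt (Real.rpow_nonneg ht _),
      ← Real.rpow_mul ht, show (q - 1) * (p - 1) = 1 by linarith [h.mul_eq_add], Real.rpow_one]
  rcases le_total 0 t with ht | ht
  · exact key t ht
  · rw [← neg_inj, ← signedPow_neg, ← signedPow_neg]
    exact key (-t) (neg_nonneg.2 ht)

theorem signedPow_div_rpow (P : ℝ) {c : ℝ} (hc : 0 < c) (x e : ℝ) :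
    signedPow P (x / c ^ e) = signedPow P x / c ^ ((P - 1) * e) := by
  have hce : 0 < c ^ e := Real.rpow_pos_of_pos hc e
  have h : signedPow P (c ^ e) = c ^ ((P - 1) * e) := by
    rw [signedPow_of_pos P hce, ← Real.rpow_mul hc.le, mul_comm]
  rw [eq_div_iff (Real.rpow_pos_of_pos hc _).ne', ← h, ← signedPow_mul,
    div_mul_cancel₀ _ hce.ne']

/-! ### Quadrants -/

/-- The point `(x, y)` lies in the closed `k`-th quadrant; quadrants are counted along the rotation
that takes `(0, 1)` to `(1, 0)`, so that quadrants `k` and `k + 4` coincide. -/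
def InQuadrant : ℕ → ℝ → ℝ → Prop
  | 0, x, y => 0 ≤ x ∧ 0 ≤ y
  | k + 1, x, y => InQuadrant k (-y) x

theorem InQuadrant.scale {k : ℕ} {x y s : ℝ} (h : InQuadrant k x y) {r : ℝ} (hr : 0 ≤ r)
    (hs : 0 ≤ s) : InQuadrant k (r * x) (s * y) := by
  induction k generalizing x y r s with
  | zero => exact ⟨mul_nonneg hr h.1, mul_nonneg hs h.2⟩
  | succ k ih =>
    have := ih (x := -y) (y := x) h hs hr
    rwa [mul_neg] at this

theorem isClosed_inQuadrant (k : ℕ) : IsClosed {z : ℝ × ℝ | InQuadrant k z.1 z.2} := by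
  induction k with
  | zero =>
    exact (isClosed_le continuous_const continuous_fst).inter
      (isClosed_le continuous_const continuous_snd)
  | succ k ih => exact ih.preimage (continuous_snd.neg.prodMk continuous_fst)

theorem InQuadrant.axis_of_succ {k : ℕ} {x y : ℝ} (h : InQuadrant k x y)
    (h' : InQuadrant (k + 1) x y) : (Even k → y = 0) ∧ (Odd k → x = 0) := by
  induction k generalizing x y with
  | zero => exact ⟨fun _ => le_antisymm (neg_nonneg.1 h'.1) h.2, fun h => by simp at h⟩
  | succ k ih =>
    obtain ⟨h₁, h₂⟩ := ih (x := -y) (y := x) h h'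
    rw [Nat.even_add_one, Nat.not_even_iff_odd, Nat.odd_add_one, Nat.not_odd_iff_even]
    exact ⟨fun hk => neg_eq_zero.1 (h₂ hk), h₁⟩

theorem inQuadrant_sin_cos {ρ θ : ℝ} (hρ : 0 ≤ ρ) {k : ℕ} (h₁ : k * (Real.pi / 2) ≤ θ)
    (h₂ : θ ≤ (k + 1) * (Real.pi / 2)) : InQuadrant k (ρ * Real.sin θ) (ρ * Real.cos θ) := by
  induction k generalizing θ with
  | zero =>
    simp only [CharP.cast_eq_zero, zero_mul, zero_add, one_mul] at h₁ h₂
    exact ⟨mul_nonneg hρ (Real.sin_nonneg_of_nonneg_of_le_pi h₁ (by linarith)),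
      mul_nonneg hρ (Real.cos_nonneg_of_neg_pi_div_two_le_of_le (by linarith) h₂)⟩
  | succ k ih =>
    push_cast at h₁ h₂
    have := ih (θ := θ - Real.pi / 2) (by linarith) (by linarith)
    rwa [Real.sin_sub_pi_div_two, Real.cos_sub_pi_div_two, mul_neg] at this

/-- A rotation by less than `π` that keeps one coordinate fixed crosses at most one axis. -/
theorem lt_of_sin_eq_or_cos_eq {ρ ρ' θ θ' : ℝ} (hρ : 0 < ρ) (hρ' : 0 < ρ') (hlt : θ' < θ + Real.pi)
    (h : ρ * Real.sin θ = ρ' * Real.sin θ' ∨ ρ * Real.cos θ = ρ' * Real.cos θ') {k : ℕ}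
    (h₁ : k * (Real.pi / 2) ≤ θ) (h₂ : θ < (k + 1) * (Real.pi / 2)) :
    θ' < (k + 2) * (Real.pi / 2) := by
  induction k generalizing θ θ' with
  | zero =>
    simp only [CharP.cast_eq_zero, zero_mul, zero_add, one_mul] at h₁ h₂ ⊢
    by_contra! hθ'
    have hθ : 0 < θ := by linarith
    rcases h with h | h
    · have hs := mul_pos hρ (Real.sin_pos_of_pos_of_lt_pi hθ (by linarith))
      have hs' := Real.sin_nonneg_of_nonneg_of_le_pi (x := θ' - Real.pi)
        (by linarith) (by linarith)
      rw [Real.sin_sub_pi] at hs'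
      nlinarith
    · have hc := mul_pos hρ (Real.cos_pos_of_mem_Ioo ⟨by linarith, h₂⟩)
      have hc' := Real.cos_nonneg_of_neg_pi_div_two_le_of_le (x := θ' - Real.pi)
        (by linarith) (by linarith)
      rw [Real.cos_sub_pi] at hc'
      nlinarith
  | succ k ih =>
    push_cast at h₁ h₂ ⊢
    have := ih (θ := θ - Real.pi / 2) (θ' := θ' - Real.pi / 2) (by linarith)
      (by
        simp only [Real.sin_sub_pi_div_two, Real.cos_sub_pi_div_two, mul_neg, neg_inj]
        exact h.symm)
      (by linarith) (by linarith)
    linarith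

theorem lt_of_alternating_cos {θ : ℕ → ℝ} (hθ : Monotone θ) (h₀ : 0 ≤ θ 0) {k : ℕ}
    (hcos : ∀ i ≤ k, 0 < (-1) ^ i * Real.cos (θ i)) : (2 * k - 1) * (Real.pi / 2) < θ k := by
  induction k with
  | zero =>
    simp only [CharP.cast_eq_zero]
    linarith [Real.pi_pos]
  | succ k ih =>
    have hk := (ih fun i hi => hcos i (hi.trans k.le_succ)).trans_le (hθ k.le_succ)
    by_contra! hle
    push_cast at hle
    have hc : 0 ≤ Real.cos (θ (k + 1) - k * Real.pi) :=
      Real.cos_nonneg_of_neg_pi_div_two_le_of_le (by linarith) (by linarith)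
    have := hcos (k + 1) le_rfl
    rw [Real.cos_sub_nat_mul_pi] at hc
    rw [pow_succ] at this
    linarith

/-! ### The splitting scheme and its rotation angle -/

/-- The splitting scheme for the planar system `dF = φ_P(G) dm`, `dG = -φ_Q(F) dl`, where
`φ_P = signedPow P`: in each step at most one of the two coordinates moves. -/
structure IsKick (P Q : ℝ) (m l F G : ℕ → ℝ) : Prop where
  fst_mass_nonneg : ∀ j, 0 ≤ m j
  snd_mass_nonneg : ∀ j, 0 ≤ l j
  mass_mul_mass : ∀ j, m j * l j = 0
  fst_succ : ∀ j, F (j + 1) = F j + m j * signedPow P (G j)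
  snd_succ : ∀ j, G (j + 1) = G j - l j * signedPow Q (F j)

/-- The planar sequence `(F, G)` as the complex sequence `G + iF`, which a splitting scheme turns
counterclockwise. -/
def point (F G : ℕ → ℝ) (j : ℕ) : ℂ := ⟨G j, F j⟩

/-- The total rotation angle of a planar sequence. -/
noncomputable def angle (F G : ℕ → ℝ) (j : ℕ) : ℝ :=
  ∑ i ∈ Finset.range j, (point F G (i + 1) / point F G i).arg

theorem angle_succ (F G : ℕ → ℝ) (j : ℕ) :
    angle F G (j + 1) = angle F G j + (point F G (j + 1) / point F G j).arg :=
  Finset.sum_range_succ _ _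

namespace IsKick

variable {P Q : ℝ} {m l F G : ℕ → ℝ}

theorem rotate (h : IsKick P Q m l F G) : IsKick Q P l m (-G) F where
  fst_mass_nonneg := h.snd_mass_nonneg
  snd_mass_nonneg := h.fst_mass_nonneg
  mass_mul_mass j := by rw [mul_comm, h.mass_mul_mass]
  fst_succ j := by
    simp only [Pi.neg_apply, h.snd_succ]
    ring
  snd_succ j := by
    simp only [Pi.neg_apply, signedPow_neg, h.fst_succ]
    ring

theorem fst_or_snd_succ_eq (h : IsKick P Q m l F G) (j : ℕ) :
    F (j + 1) = F j ∨ G (j + 1) = G j := by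
  rw [h.fst_succ, h.snd_succ]
  rcases mul_eq_zero.1 (h.mass_mul_mass j) with hm | hl
  · simp [hm]
  · simp [hl]

theorem point_ne_zero (h : IsKick P Q m l F G) (h₀ : point F G 0 ≠ 0) (j : ℕ) :
    point F G j ≠ 0 := by
  induction j with
  | zero => exact h₀
  | succ j ih =>
    contrapose! ih
    obtain ⟨hG, hF⟩ := Complex.ext_iff.1 ih
    change G (j + 1) = 0 at hG
    change F (j + 1) = 0 at hF
    have hF' := h.fst_succ j
    have hG' := h.snd_succ j
    rcases h.fst_or_snd_succ_eq j with heq | heq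
    · rw [← heq, hF, signedPow_zero, mul_zero, sub_zero] at hG'
      exact Complex.ext (hG'.symm.trans hG) (heq.symm.trans hF)
    · rw [← heq, hG, signedPow_zero, mul_zero, add_zero] at hF'
      exact Complex.ext (heq.symm.trans hG) (hF'.symm.trans hF)

theorem ratio_im (h : IsKick P Q m l F G) (j : ℕ) : (point F G (j + 1) / point F G j).im =
    (m j * (signedPow P (G j) * G j) + l j * (signedPow Q (F j) * F j)) /
      Complex.normSq (point F G j) := by
  rw [Complex.div_im]
  simp only [point, h.fst_succ, h.snd_succ]
  ring

theorem ratio_im_pos (h : IsKick P Q m l F G) {j : ℕ} (hj : point F G j ≠ 0)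
    (hmove : point F G (j + 1) ≠ point F G j) : 0 < (point F G (j + 1) / point F G j).im := by
  rw [h.ratio_im]
  refine div_pos (lt_of_le_of_ne ?_ fun h₀ => hmove ?_) (Complex.normSq_pos.2 hj)
  · exact add_nonneg (mul_nonneg (h.fst_mass_nonneg j) (signedPow_mul_self_nonneg _ _))
      (mul_nonneg (h.snd_mass_nonneg j) (signedPow_mul_self_nonneg _ _))
  · have key : ∀ {R s t : ℝ}, s * (signedPow R t * t) = 0 → s * signedPow R t = 0 :=
      fun {R s t} hst => by
        rcases eq_or_ne t 0 with rfl | ht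
        · rw [signedPow_zero, mul_zero]
        · rw [(mul_eq_zero_iff_right (signedPow_mul_self_pos ht).ne').1 hst, zero_mul]
    obtain ⟨hm, hl⟩ := (add_eq_zero_iff_of_nonneg
      (mul_nonneg (h.fst_mass_nonneg j) (signedPow_mul_self_nonneg _ _))
      (mul_nonneg (h.snd_mass_nonneg j) (signedPow_mul_self_nonneg _ _))).1 h₀.symm
    simp only [point, h.fst_succ, h.snd_succ, key hm, key hl, add_zero, sub_zero]

theorem ratio_mem_slitPlane (h : IsKick P Q m l F G) {j : ℕ} (hj : point F G j ≠ 0) :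
    point F G (j + 1) / point F G j ∈ Complex.slitPlane := by
  by_cases hmove : point F G (j + 1) = point F G j
  · rw [hmove, div_self hj]
    exact Complex.one_mem_slitPlane
  · exact Or.inr (h.ratio_im_pos hj hmove).ne'

theorem angle_lt_succ (h : IsKick P Q m l F G) {j : ℕ} (hj : point F G j ≠ 0)
    (hmove : point F G (j + 1) ≠ point F G j) : angle F G j < angle F G (j + 1) := by
  have him := h.ratio_im_pos hj hmove
  have harg := (Complex.arg_nonneg_iff.2 him.le).lt_of_ne fun h₀ =>
    him.ne' (Complex.arg_eq_zero_iff.1 h₀.symm).2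
  rw [angle_succ]
  linarith

theorem monotone_angle (h : IsKick P Q m l F G) (h₀ : point F G 0 ≠ 0) :
    Monotone (angle F G) := by
  refine monotone_nat_of_le_succ fun j => ?_
  by_cases hmove : point F G (j + 1) = point F G j
  · rw [angle_succ, hmove, div_self (h.point_ne_zero h₀ j), Complex.arg_one, add_zero]
  · exact (h.angle_lt_succ (h.point_ne_zero h₀ j) hmove).le

theorem angle_nonneg (h : IsKick P Q m l F G) (h₀ : point F G 0 ≠ 0) (j : ℕ) :
    0 ≤ angle F G j := by
  simpa [angle] using h.monotone_angle h₀ (Nat.zero_le j)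

theorem angle_succ_lt (h : IsKick P Q m l F G) {j : ℕ} (hj : point F G j ≠ 0) :
    angle F G (j + 1) < angle F G j + Real.pi := by
  rw [angle_succ]
  have := (Complex.arg_le_pi _).lt_of_ne (Complex.slitPlane_arg_ne_pi (h.ratio_mem_slitPlane hj))
  linarith

theorem exists_polar (h : IsKick P Q m l F G) (h₀ : point F G 0 = 1) (j : ℕ) :
    ∃ ρ > 0, F j = ρ * Real.sin (angle F G j) ∧ G j = ρ * Real.cos (angle F G j) := by
  have hne := h.point_ne_zero (h₀ ▸ one_ne_zero)
  have key : point F G j = (‖point F G j‖ : ℂ) * Complex.exp (angle F G j * Complex.I) := by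
    induction j with
    | zero => simp [angle, h₀]
    | succ j ih =>
      set w := point F G (j + 1) / point F G j with hw
      have e : point F G (j + 1) = w * point F G j := by rw [hw, div_mul_cancel₀ _ (hne j)]
      rw [angle_succ, ← hw, e, norm_mul]
      conv_lhs => rw [ih, ← Complex.norm_mul_exp_arg_mul_I w]
      push_cast
      rw [add_mul, Complex.exp_add]
      ring
  refine ⟨‖point F G j‖, norm_pos_iff.2 (hne j), ?_, ?_⟩
  · have := congrArg Complex.im key
    rwa [Complex.im_ofReal_mul, Complex.exp_ofReal_mul_I_im] at this
  · have := congrArg Complex.re key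
    rwa [Complex.re_ofReal_mul, Complex.exp_ofReal_mul_I_re] at this

end IsKick

/-- Masses for which a splitting scheme moves the two coordinates in turn. -/
structure IsAlternating (m l : ℕ → ℝ) : Prop where
  fst_even : ∀ k, 0 < m (2 * k)
  fst_odd : ∀ k, m (2 * k + 1) = 0
  snd_even : ∀ k, l (2 * k) = 0
  snd_odd : ∀ k, 0 < l (2 * k + 1)

/-- The solution of the splitting scheme issued from `(0, 1)`. -/
noncomputable def kick (P Q : ℝ) (m l : ℕ → ℝ) : ℕ → ℝ × ℝ
  | 0 => (0, 1)
  | j + 1 => ((kick P Q m l j).1 + m j * signedPow P (kick P Q m l j).2,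
      (kick P Q m l j).2 - l j * signedPow Q (kick P Q m l j).1)

theorem IsAlternating.isKick_kick {m l : ℕ → ℝ} (h : IsAlternating m l) (P Q : ℝ) {c : ℝ}
    (hc : 0 ≤ c) : IsKick P Q (fun j => c * m j) l (fun j => (kick P Q (fun j => c * m j) l j).1)
      (fun j => (kick P Q (fun j => c * m j) l j).2) where
  fst_mass_nonneg j := by
    rcases Nat.even_or_odd' j with ⟨i, rfl | rfl⟩
    · exact mul_nonneg hc (h.fst_even i).le
    · rw [h.fst_odd, mul_zero]
  snd_mass_nonneg j := by
    rcases Nat.even_or_odd' j with ⟨i, rfl | rfl⟩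
    exacts [(h.snd_even i).ge, (h.snd_odd i).le]
  mass_mul_mass j := by
    rcases Nat.even_or_odd' j with ⟨i, rfl | rfl⟩
    · rw [h.snd_even, mul_zero]
    · rw [h.fst_odd, mul_zero, zero_mul]
  fst_succ _ := rfl
  snd_succ _ := rfl

theorem tendsto_div_rpow_of_lt {f : ℝ → ℝ} {d e γ : ℝ} (hde : d < e)
    (hf : Tendsto (fun c => f c / c ^ d) atTop (𝓝 γ)) :
    Tendsto (fun c => f c / c ^ e) atTop (𝓝 0) := by
  have := hf.mul (tendsto_rpow_neg_atTop (sub_pos.2 hde))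
  rw [mul_zero] at this
  refine this.congr' ?_
  filter_upwards [eventually_gt_atTop 0] with c hc
  rw [neg_sub, Real.rpow_sub hc]
  have := (Real.rpow_pos_of_pos hc d).ne'
  field_simp

theorem tendsto_kick_div_rpow {P : ℝ} (hP : 1 < P) {f g : ℝ → ℝ} {s e α γ : ℝ} (r : ℝ)
    (hf : Tendsto (fun c => f c / c ^ (s + (P - 1) * e)) atTop (𝓝 α))
    (hg : Tendsto (fun c => g c / c ^ e) atTop (𝓝 γ)) :
    Tendsto (fun c => (f c + c ^ s * r * signedPow P (g c)) / c ^ (s + (P - 1) * e)) atTop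
      (𝓝 (α + r * signedPow P γ)) := by
  refine (hf.add ((((continuous_signedPow hP).tendsto γ).comp hg).const_mul r)).congr' ?_
  filter_upwards [eventually_gt_atTop 0] with c hc
  rw [Function.comp_apply, signedPow_div_rpow P hc, add_div, Real.rpow_add hc]
  have hs := (Real.rpow_pos_of_pos hc s).ne'
  have he := (Real.rpow_pos_of_pos hc ((P - 1) * e)).ne'
  field_simp

section Shooting

variable {P Q : ℝ} {m l : ℕ → ℝ}

theorem IsAlternating.kick_asymptotics (h : IsAlternating m l) (hP : 1 < P) (hQ : 1 < Q) (k : ℕ) :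
    ∃ e γ : ℝ, 0 < (-1) ^ k * γ ∧ e < (Q - 1) * (1 + (P - 1) * e) ∧
      Tendsto (fun c => (kick P Q (fun j => c * m j) l (2 * k)).2 / c ^ e) atTop (𝓝 γ) ∧
      Tendsto (fun c => (kick P Q (fun j => c * m j) l (2 * k)).1 / c ^ (1 + (P - 1) * e))
        atTop (𝓝 0) := by
  induction k with
  | zero => exact ⟨0, 1, by simp, by linarith, by simp [kick], by simp [kick]⟩
  | succ k ih =>
    obtain ⟨e, γ, hγ, he, hG, hF⟩ := ih
    set d := 1 + (P - 1) * e
    set δ := m (2 * k) * signedPow P γ with hδ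
    have hFd : Tendsto (fun c => (kick P Q (fun j => c * m j) l (2 * k + 1)).1 / c ^ d) atTop
        (𝓝 δ) := by
      simpa only [kick, Real.rpow_one, zero_add] using tendsto_kick_div_rpow hP (m (2 * k)) hF hG
    have hde : (P - 1) * e < (P - 1) * ((Q - 1) * d) := mul_lt_mul_of_pos_left he (by linarith)
    have hGd : Tendsto (fun c => (kick P Q (fun j => c * m j) l (2 * (k + 1))).2 /
        c ^ ((Q - 1) * d)) atTop (𝓝 (-l (2 * k + 1) * signedPow Q δ)) := by
      have hG₀ : Tendsto (fun c => (kick P Q (fun j => c * m j) l (2 * k)).2 /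
          c ^ (0 + (Q - 1) * d)) atTop (𝓝 0) := tendsto_div_rpow_of_lt (by rwa [zero_add]) hG
      simpa [Nat.mul_add, kick, h.snd_even, sub_eq_add_neg] using
        tendsto_kick_div_rpow hQ (-l (2 * k + 1)) hG₀ hFd
    refine ⟨(Q - 1) * d, -l (2 * k + 1) * signedPow Q δ, ?_,
      mul_lt_mul_of_pos_left (by linarith) (by linarith), hGd, ?_⟩
    · have hsign : ∀ R {t}, 0 < (-1) ^ k * t → 0 < (-1) ^ k * signedPow R t := fun R t ht => by
        simpa only [signedPow_mul, signedPow_neg_one_pow] using signedPow_pos (P := R) ht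
      have hδ' : 0 < (-1) ^ k * δ := by
        rw [hδ, mul_left_comm]
        exact mul_pos (h.fst_even k) (hsign P hγ)
      have := mul_pos (h.snd_odd k) (hsign Q hδ')
      rw [pow_succ]
      linarith
    · have hF₁ := tendsto_div_rpow_of_lt (e := 1 + (P - 1) * ((Q - 1) * d)) (by linarith) hFd
      simpa [Nat.mul_add, kick, h.fst_odd] using hF₁

theorem continuous_kick (hP : 1 < P) (hQ : 1 < Q) (m l : ℕ → ℝ) (j : ℕ) :
    Continuous fun c : ℝ => kick P Q (fun j => c * m j) l j := by
  induction j with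
  | zero => exact continuous_const
  | succ j ih =>
    have hP' := continuous_signedPow hP
    have hQ' := continuous_signedPow hQ
    simp only [kick]
    fun_prop

/-- The rotation angle of the splitting scheme issued from `(0, 1)` with first masses scaled by `c`,
as a function of the shooting parameter `c`. -/
noncomputable def kickAngle (P Q : ℝ) (m l : ℕ → ℝ) (j : ℕ) (c : ℝ) : ℝ :=
  angle (fun j => (kick P Q (fun j => c * m j) l j).1)
    (fun j => (kick P Q (fun j => c * m j) l j).2) j

theorem kickAngle_zero (P Q : ℝ) (m l : ℕ → ℝ) (j : ℕ) : kickAngle P Q m l j 0 = 0 := by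
  have h₀ : ∀ j, kick P Q (fun j => 0 * m j) l j = (0, 1) := fun j => by
    induction j with
    | zero => rfl
    | succ j ih => rw [kick, ih, signedPow_zero, zero_mul, zero_mul, mul_zero, add_zero, sub_zero]
  simp only [kickAngle, angle, point, h₀, div_self (show (⟨1, 0⟩ : ℂ) ≠ 0 from one_ne_zero),
    Complex.arg_one, Finset.sum_const_zero]

theorem IsAlternating.continuousOn_kickAngle (h : IsAlternating m l) (hP : 1 < P) (hQ : 1 < Q)
    (j : ℕ) : ContinuousOn (kickAngle P Q m l j) (Set.Ici 0) := by
  unfold kickAngle angle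
  refine continuousOn_finsetSum _ fun i _ c hc => ?_
  have hkick := h.isKick_kick P Q (c := c) hc
  have hne := hkick.point_ne_zero (one_ne_zero (α := ℂ))
  have hpoint : ∀ i, Continuous fun c => point (fun j => (kick P Q (fun j => c * m j) l j).1)
      (fun j => (kick P Q (fun j => c * m j) l j).2) i := fun i =>
    Complex.equivRealProdCLM.symm.continuous.comp
      (continuous_swap.comp (continuous_kick hP hQ m l i))
  refine ContinuousAt.comp_continuousWithinAt (g := Complex.arg)
    (Complex.continuousAt_arg (hkick.ratio_mem_slitPlane (hne i))) ?_
  exact ((hpoint (i + 1)).continuousAt.div (hpoint i).continuousAt (hne i)).continuousWithinAt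

theorem IsAlternating.eventually_lt_kickAngle (h : IsAlternating m l) (hP : 1 < P) (hQ : 1 < Q)
    (k : ℕ) : ∀ᶠ c in atTop, (2 * k - 1) * (Real.pi / 2) < kickAngle P Q m l (2 * k) c := by
  have hev : ∀ᶠ c in atTop, ∀ i ∈ Finset.range (k + 1),
      0 < (-1) ^ i * (kick P Q (fun j => c * m j) l (2 * i)).2 := by
    rw [eventually_all_finset]
    intro i _
    obtain ⟨e, γ, hγ, -, hG, -⟩ := h.kick_asymptotics hP hQ i
    filter_upwards [(hG.const_mul ((-1) ^ i)).eventually_const_lt hγ, eventually_gt_atTop 0]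
      with c hc hc0
    rw [← mul_div_assoc] at hc
    exact (div_pos_iff_of_pos_right (Real.rpow_pos_of_pos hc0 e)).1 hc
  filter_upwards [hev, eventually_ge_atTop 0] with c hsign hc
  have hkick := h.isKick_kick P Q hc
  have h₀ := one_ne_zero (α := ℂ)
  refine lt_of_alternating_cos
    ((hkick.monotone_angle h₀).comp fun i j (hij : i ≤ j) => Nat.mul_le_mul_left 2 hij)
    (hkick.angle_nonneg h₀ _) fun i hi => ?_
  obtain ⟨ρ, hρ, -, hcos⟩ := hkick.exists_polar rfl (2 * i)
  have := hsign i (Finset.mem_range.2 (Nat.lt_succ_of_le hi))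
  rw [hcos, mul_left_comm] at this
  exact pos_of_mul_pos_right this hρ.le

theorem IsAlternating.exists_kickAngle_eq (h : IsAlternating m l) (hP : 1 < P) (hQ : 1 < Q)
    {k : ℕ} {θ : ℝ} (hθ : 0 < θ) (hθ' : θ ≤ (2 * k - 1) * (Real.pi / 2)) :
    ∃ c > 0, kickAngle P Q m l (2 * k) c = θ := by
  obtain ⟨C, hC, hC₀⟩ := ((h.eventually_lt_kickAngle hP hQ k).and (eventually_ge_atTop 0)).exists
  obtain ⟨c, hc, rfl⟩ := intermediate_value_Icc hC₀
    ((h.continuousOn_kickAngle hP hQ (2 * k)).mono Set.Icc_subset_Ici_self)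
    ⟨(kickAngle_zero P Q m l _).trans_le hθ.le, hθ'.trans hC.le⟩
  exact ⟨c, hc.1.lt_of_ne (by rintro rfl; exact hθ.ne' (kickAngle_zero P Q m l _)), rfl⟩

end Shooting

/-! ### Winding sequences -/

/-- The index of the quadrant in which the rotation angle of a planar sequence lies. -/
noncomputable def quadrant (F G : ℕ → ℝ) (j : ℕ) : ℕ := ⌊angle F G j / (Real.pi / 2)⌋₊

namespace IsKick

variable {P Q : ℝ} {m l F G : ℕ → ℝ}

theorem monotone_quadrant (h : IsKick P Q m l F G) (h₀ : point F G 0 ≠ 0) :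
    Monotone (quadrant F G) := fun _ _ hij =>
  Nat.floor_le_floor (div_le_div_of_nonneg_right (h.monotone_angle h₀ hij) Real.pi_div_two_pos.le)

theorem quadrant_mul_le_angle (h : IsKick P Q m l F G) (h₀ : point F G 0 ≠ 0) (j : ℕ) :
    quadrant F G j * (Real.pi / 2) ≤ angle F G j :=
  (le_div_iff₀ Real.pi_div_two_pos).1
    (Nat.floor_le (div_nonneg (h.angle_nonneg h₀ j) Real.pi_div_two_pos.le))

theorem quadrant_lt (h : IsKick P Q m l F G) (h₀ : point F G 0 ≠ 0) {j k : ℕ}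
    (hk : angle F G j < k * (Real.pi / 2)) : quadrant F G j < k := by
  have := (h.quadrant_mul_le_angle h₀ j).trans_lt hk
  exact_mod_cast lt_of_mul_lt_mul_right this Real.pi_div_two_pos.le

theorem angle_lt_quadrant_add_one (F G : ℕ → ℝ) (j : ℕ) :
    angle F G j < (quadrant F G j + 1) * (Real.pi / 2) :=
  (div_lt_iff₀ Real.pi_div_two_pos).1 (Nat.lt_floor_add_one _)

theorem inQuadrant_quadrant (h : IsKick P Q m l F G) (h₀ : point F G 0 = 1) (j : ℕ) :
    InQuadrant (quadrant F G j) (F j) (G j) := by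
  obtain ⟨ρ, hρ, hF, hG⟩ := h.exists_polar h₀ j
  rw [hF, hG]
  exact inQuadrant_sin_cos hρ.le (h.quadrant_mul_le_angle (h₀ ▸ one_ne_zero) j)
    (angle_lt_quadrant_add_one F G j).le

theorem quadrant_succ_le (h : IsKick P Q m l F G) (h₀ : point F G 0 = 1) (j : ℕ) :
    quadrant F G (j + 1) ≤ quadrant F G j + 1 := by
  have hne : point F G 0 ≠ 0 := h₀ ▸ one_ne_zero
  obtain ⟨ρ, hρ, hF, hG⟩ := h.exists_polar h₀ j
  obtain ⟨ρ', hρ', hF', hG'⟩ := h.exists_polar h₀ (j + 1)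
  have hlt := lt_of_sin_eq_or_cos_eq hρ hρ' (h.angle_succ_lt (h.point_ne_zero hne j))
    (by rw [← hF, ← hF', ← hG, ← hG']; exact (h.fst_or_snd_succ_eq j).imp Eq.symm Eq.symm)
    (h.quadrant_mul_le_angle hne j) (angle_lt_quadrant_add_one F G j)
  exact Nat.lt_succ_iff.1 (h.quadrant_lt hne (by exact_mod_cast hlt))

theorem angle_lt_succ_of_snd_eq_zero (h : IsKick P Q m l F G) {j : ℕ} (hj : point F G j ≠ 0)
    (hl : l j ≠ 0) (hG : G (j + 1) = 0) : angle F G j < angle F G (j + 1) := by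
  refine h.angle_lt_succ hj fun hstay => hj (Complex.ext ?_ ?_)
  · exact (congrArg Complex.re hstay).symm.trans hG
  · have hGj : G j = 0 := (congrArg Complex.re hstay).symm.trans hG
    have hF := h.snd_succ j
    rw [hG, hGj, zero_sub, zero_eq_neg] at hF
    by_contra hF'
    exact mul_ne_zero hl (signedPow_ne_zero hF') hF

end IsKick

theorem exists_blocks {κ : ℕ → ℕ} (hκ : Monotone κ) (h₀ : κ 0 = 0)
    (hstep : ∀ j, κ (j + 1) ≤ κ j + 1) {K L : ℕ} (hlast : κ L = K) (hlt : ∀ j < L, κ j < K) :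
    ∃ s : ℕ → ℕ, s 0 = 0 ∧ s K = L ∧
      ∀ k < K, s k < s (k + 1) ∧ ∀ j, s k ≤ j → j < s (k + 1) → κ j = k := by
  classical
  have hex : ∀ k, k ≤ K → ∃ j, k ≤ κ j := fun k hk => ⟨L, hk.trans hlast.ge⟩
  have hle : ∀ {k j}, k ≤ K → (sInf {j | k ≤ κ j} ≤ j ↔ k ≤ κ j) := fun {k j} hk =>
    ⟨fun hj => le_trans (show k ≤ κ _ from Nat.sInf_mem (hex k hk)) (hκ hj),
      fun hj => Nat.sInf_le hj⟩
  refine ⟨fun k => sInf {j | k ≤ κ j}, ?_, ?_, fun k hk => ?_⟩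
  · exact Nat.le_zero.1 ((hle K.zero_le).2 (Nat.zero_le _))
  · refine le_antisymm ((hle le_rfl).2 hlast.ge) (not_lt.1 fun hL => ?_)
    exact (hlt _ hL).not_ge ((hle le_rfl).1 le_rfl)
  · have hblock : ∀ j, sInf {j | k ≤ κ j} ≤ j → j < sInf {j | k + 1 ≤ κ j} → κ j = k :=
      fun j h₁ h₂ => le_antisymm
        (Nat.lt_succ_iff.1 (not_le.1 fun h => h₂.not_ge ((hle hk).2 h))) ((hle hk.le).1 h₁)
    refine ⟨not_le.1 fun h => ?_, hblock⟩
    have hreach : k + 1 ≤ κ (sInf {j | k ≤ κ j}) := (hle hk).1 h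
    rcases hi : sInf {j | k ≤ κ j} with _ | i
    · rw [hi, h₀] at hreach
      omega
    · rw [hi] at hreach
      have := (hle hk.le).2 (Nat.le_of_succ_le_succ (hreach.trans (hstep _)))
      omega

/-- A planar sequence of length `L` that starts on the axis `F = 0`, runs through the quadrants
`0, 1, …, 2n` in order, being in quadrant `k` for the indices from `s k` to `s (k + 1) - 1`, and
ends on the axis `G = 0`. -/
structure IsWinding (n L : ℕ) (s : ℕ → ℕ) (F G : ℕ → ℝ) : Prop where
  fst_zero : F 0 = 0
  snd_last : G L = 0
  ne_zero : ∀ j, point F G j ≠ 0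
  start : s 0 = 0
  last : s (2 * n + 1) = L
  lt : ∀ k ≤ 2 * n, s k < s (k + 1)
  mem : ∀ k ≤ 2 * n, ∀ j, s k ≤ j → j < s (k + 1) → InQuadrant k (F j) (G j)

namespace IsWinding

variable {n L : ℕ} {s : ℕ → ℕ} {F G : ℕ → ℝ}

theorem strictMonoOn (h : IsWinding n L s F G) : StrictMonoOn s (Set.Iic (2 * n + 1)) :=
  strictMonoOn_of_lt_succ Set.ordConnected_Iic fun k _ _ hk => h.lt k (Nat.lt_succ_iff.1 hk)

theorem le_last (h : IsWinding n L s F G) {k : ℕ} (hk : k ≤ 2 * n + 1) : s k ≤ L :=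
  (h.strictMonoOn.monotoneOn hk Set.self_mem_Iic hk).trans_eq h.last

theorem exists_long_block (h : IsWinding n L s F G) :
    ∃ k ≤ 2 * n, L ≤ (2 * n + 1) * (s (k + 1) - s k) := by
  have hsum : ∑ _k ∈ Finset.range (2 * n + 1), (L : ℤ) ≤
      ∑ k ∈ Finset.range (2 * n + 1), (2 * n + 1) * ((s (k + 1) : ℤ) - s k) := by
    rw [← Finset.mul_sum, Finset.sum_range_sub (fun k => (s k : ℤ)), h.last, h.start]
    simp
  obtain ⟨k, hk, hle⟩ := Finset.exists_le_of_sum_le ⟨0, by simp⟩ hsum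
  have hk' : k ≤ 2 * n := Nat.lt_succ_iff.1 (Finset.mem_range.1 hk)
  refine ⟨k, hk', ?_⟩
  rw [← Nat.cast_sub (h.lt k hk').le] at hle
  exact_mod_cast hle

end IsWinding

theorem IsKick.exists_isWinding {P Q : ℝ} {m l F G : ℕ → ℝ} (h : IsKick P Q m l F G)
    (h₀ : point F G 0 = 1) {n L : ℕ} (hl : l L ≠ 0)
    (hangle : angle F G (L + 1) = (2 * n + 1) * (Real.pi / 2)) :
    ∃ s, IsWinding n (L + 1) s F G := by
  have h₀' : point F G 0 ≠ 0 := h₀ ▸ one_ne_zero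
  have hne := h.point_ne_zero h₀'
  have hsnd : G (L + 1) = 0 := by
    obtain ⟨ρ, -, -, hG⟩ := h.exists_polar h₀ (L + 1)
    rw [hG, hangle, show (2 * (n : ℝ) + 1) * (Real.pi / 2) = Real.pi / 2 + n * Real.pi by ring,
      Real.cos_add_nat_mul_pi, Real.cos_pi_div_two, mul_zero, mul_zero]
  have hstart : quadrant F G 0 = 0 := by simp [quadrant, angle]
  have hlast : quadrant F G (L + 1) = 2 * n + 1 := by
    rw [quadrant, hangle, mul_div_assoc, div_self Real.pi_div_two_pos.ne', mul_one]
    exact_mod_cast Nat.floor_natCast (2 * n + 1)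
  have hlt : ∀ j < L + 1, quadrant F G j < 2 * n + 1 := fun j hj =>
    h.quadrant_lt h₀' <| calc
      angle F G j ≤ angle F G L := h.monotone_angle h₀' (Nat.lt_succ_iff.1 hj)
      _ < angle F G (L + 1) := h.angle_lt_succ_of_snd_eq_zero (hne L) hl hsnd
      _ = _ := by rw [hangle]; push_cast; rfl
  obtain ⟨s, hs₀, hsL, hs⟩ := exists_blocks (h.monotone_quadrant h₀') hstart
    (h.quadrant_succ_le h₀) hlast hlt
  refine ⟨s, congrArg Complex.im h₀, hsnd, hne, hs₀, hsL,
    fun k hk => (hs k (Nat.lt_succ_of_le hk)).1, fun k hk j h₁ h₂ => ?_⟩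
  rw [← (hs k (Nat.lt_succ_of_le hk)).2 j h₁ h₂]
  exact h.inQuadrant_quadrant h₀ j

theorem IsAlternating.exists_isWinding {P Q : ℝ} {m l : ℕ → ℝ} (h : IsAlternating m l)
    (hP : 1 < P) (hQ : 1 < Q) {n N : ℕ} (hN : n < N) :
    ∃ c > 0, ∃ (F G : ℕ → ℝ) (s : ℕ → ℕ), IsKick P Q (fun j => c * m j) l F G ∧
      IsWinding n (2 * N) s F G := by
  have hle : (2 * n + 1) * (Real.pi / 2) ≤ (2 * N - 1) * (Real.pi / 2) := by
    have : (n : ℝ) + 1 ≤ N := by exact_mod_cast hN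
    gcongr
    linarith
  obtain ⟨c, hc, hangle⟩ := h.exists_kickAngle_eq hP hQ (by positivity) hle
  obtain ⟨i, rfl⟩ := Nat.exists_eq_succ_of_ne_zero (n.zero_le.trans_lt hN).ne'
  have hkick := h.isKick_kick P Q hc.le
  obtain ⟨s, hs⟩ := hkick.exists_isWinding rfl (h.snd_odd i).ne' hangle
  exact ⟨c, hc, _, _, s, hkick, hs⟩

/-! ### Growth of splitting schemes within and across quadrants -/

namespace IsKick

variable {P Q : ℝ} {m l F G : ℕ → ℝ}

theorem fst_eq_add_sum (h : IsKick P Q m l F G) {i j : ℕ} (hij : i ≤ j) :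
    F j = F i + ∑ x ∈ Finset.Ico i j, m x * signedPow P (G x) := by
  induction j, hij using Nat.le_induction with
  | base => simp
  | succ j hij ih => rw [h.fst_succ, ih, Finset.sum_Ico_succ_top hij, add_assoc]

theorem snd_eq_sub_sum (h : IsKick P Q m l F G) {i j : ℕ} (hij : i ≤ j) :
    G j = G i - ∑ x ∈ Finset.Ico i j, l x * signedPow Q (F x) := by
  have := h.rotate.fst_eq_add_sum hij
  simp only [Pi.neg_apply] at this
  linarith

theorem fst_sub_mem_Icc (h : IsKick P Q m l F G) {i j : ℕ} (hij : i ≤ j) {lo hi : ℝ}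
    (hb : ∀ x, i ≤ x → x < j → signedPow P (G x) ∈ Set.Icc lo hi) :
    F j - F i ∈ Set.Icc ((∑ x ∈ Finset.Ico i j, m x) * lo) ((∑ x ∈ Finset.Ico i j, m x) * hi) := by
  rw [h.fst_eq_add_sum hij, add_sub_cancel_left, Finset.sum_mul, Finset.sum_mul]
  refine ⟨Finset.sum_le_sum fun x hx => ?_, Finset.sum_le_sum fun x hx => ?_⟩ <;>
    obtain ⟨h₁, h₂⟩ := Finset.mem_Ico.1 hx
  · exact mul_le_mul_of_nonneg_left (hb x h₁ h₂).1 (h.fst_mass_nonneg x)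
  · exact mul_le_mul_of_nonneg_left (hb x h₁ h₂).2 (h.fst_mass_nonneg x)

theorem fst_le_of_snd_nonneg (h : IsKick P Q m l F G) {i j : ℕ} (hij : i ≤ j)
    (hG : ∀ x, i ≤ x → x < j → 0 ≤ G x) : F i ≤ F j := by
  rw [h.fst_eq_add_sum hij, le_add_iff_nonneg_right]
  refine Finset.sum_nonneg fun x hx => mul_nonneg (h.fst_mass_nonneg x) (signedPow_nonneg ?_)
  exact hG x (Finset.mem_Ico.1 hx).1 (Finset.mem_Ico.1 hx).2

theorem snd_le_of_fst_nonneg (h : IsKick P Q m l F G) {i j : ℕ} (hij : i ≤ j)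
    (hF : ∀ x, i ≤ x → x < j → 0 ≤ F x) : G j ≤ G i :=
  neg_le_neg_iff.1 (h.rotate.fst_le_of_snd_nonneg hij hF)

theorem fst_sub_mem_Icc_of_nonneg (h : IsKick P Q m l F G) (hP : 1 < P) {i j : ℕ} (hij : i ≤ j)
    (hnn : ∀ x, i ≤ x → x ≤ j → InQuadrant 0 (F x) (G x)) :
    F j - F i ∈ Set.Icc ((∑ x ∈ Finset.Ico i j, m x) * signedPow P (G j))
      ((∑ x ∈ Finset.Ico i j, m x) * signedPow P (G i)) := by
  refine h.fst_sub_mem_Icc hij fun x h₁ h₂ => ⟨?_, ?_⟩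
  · exact signedPow_le_signedPow hP (hnn j hij le_rfl).2
      (h.snd_le_of_fst_nonneg h₂.le fun y h₃ h₄ => (hnn y (h₁.trans h₃) h₄.le).1)
  · exact signedPow_le_signedPow hP (hnn x h₁ h₂.le).2
      (h.snd_le_of_fst_nonneg h₁ fun y h₃ h₄ => (hnn y h₃ (h₄.le.trans h₂.le)).1)

theorem snd_sub_mem_Icc_of_nonneg (h : IsKick P Q m l F G) (hQ : 1 < Q) {i j : ℕ} (hij : i ≤ j)
    (hnn : ∀ x, i ≤ x → x ≤ j → InQuadrant 0 (F x) (G x)) :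
    G i - G j ∈ Set.Icc ((∑ x ∈ Finset.Ico i j, l x) * signedPow Q (F i))
      ((∑ x ∈ Finset.Ico i j, l x) * signedPow Q (F j)) := by
  rw [← neg_sub_neg]
  refine h.rotate.fst_sub_mem_Icc hij fun x h₁ h₂ => ⟨?_, ?_⟩
  · exact signedPow_le_signedPow hQ (hnn i le_rfl hij).1
      (h.fst_le_of_snd_nonneg h₁ fun y h₃ h₄ => (hnn y h₃ (h₄.le.trans h₂.le)).2)
  · exact signedPow_le_signedPow hQ (hnn x h₁ h₂.le).1
      (h.fst_le_of_snd_nonneg h₂.le fun y h₃ h₄ => (hnn y (h₁.trans h₃) h₄.le).2)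

/-- Seen from the middle of a stay in one quadrant, one coordinate has grown since the beginning of
the stay and the other has to decay until its end, so each of them dominates a power of the
other. -/
theorem mid_bounds (h : IsKick P Q m l F G) (hP : 1 < P) (hQ : 1 < Q) {k i M j : ℕ} (hiM : i ≤ M)
    (hMj : M ≤ j) (hquad : ∀ x, i ≤ x → x ≤ j → InQuadrant k (F x) (G x)) {S T : ℝ}
    (hS : S ≤ ∑ x ∈ Finset.Ico i M, m x) (hS' : S ≤ ∑ x ∈ Finset.Ico M j, m x)
    (hT : T ≤ ∑ x ∈ Finset.Ico i M, l x) (hT' : T ≤ ∑ x ∈ Finset.Ico M j, l x) :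
    S * signedPow P |G M| ≤ |F M| ∧ T * signedPow Q |F M| ≤ |G M| := by
  induction k generalizing P Q m l F G S T with
  | zero =>
    obtain ⟨hF, hG⟩ := hquad M hiM hMj
    have hgrow := (h.fst_sub_mem_Icc_of_nonneg hP hiM fun x h₁ h₂ => hquad x h₁ (h₂.trans hMj)).1
    have hdecay := (h.snd_sub_mem_Icc_of_nonneg hQ hMj fun x h₁ h₂ => hquad x (hiM.trans h₁) h₂).1
    rw [abs_of_nonneg hF, abs_of_nonneg hG]
    constructor
    · exact (mul_le_mul_of_nonneg_right hS (signedPow_nonneg hG)).trans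
        (hgrow.trans (sub_le_self _ (hquad i le_rfl (hiM.trans hMj)).1))
    · exact (mul_le_mul_of_nonneg_right hT' (signedPow_nonneg hF)).trans
        (hdecay.trans (sub_le_self _ (hquad j (hiM.trans hMj) le_rfl).2))
  | succ k ih =>
    have := ih h.rotate hQ hP hquad hT hT' hS hS'
    rwa [Pi.neg_apply, abs_neg, and_comm] at this

end IsKick

/-- Both `x` and `y` are bounded by the `e`-th iterate of `g` at the other one. -/
def IterBounded {α : Type*} [LE α] (g : α → α) (e : ℕ) (x y : α) : Prop :=
  x ≤ g^[e] y ∧ y ≤ g^[e] x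

namespace IterBounded

variable {α : Type*} [Preorder α] {g : α → α} {e e' : ℕ} {x y z : α}

theorem symm (h : IterBounded g e x y) : IterBounded g e y x := And.symm h

theorem mono (hid : id ≤ g) (h : IterBounded g e x y) (he : e ≤ e') : IterBounded g e' x y :=
  ⟨h.1.trans (Function.monotone_iterate_of_id_le hid he y),
    h.2.trans (Function.monotone_iterate_of_id_le hid he x)⟩

theorem trans (hg : Monotone g) (h : IterBounded g e x y) (h' : IterBounded g e' y z) :
    IterBounded g (e + e') x z := by
  constructor
  · rw [Function.iterate_add_apply]
    exact h.1.trans (hg.iterate e h'.1)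
  · rw [add_comm, Function.iterate_add_apply]
    exact h'.2.trans (hg.iterate e' h.2)

theorem of_blocks (hg : Monotone g) (hid : id ≤ g) {ν : ℕ → α} {s : ℕ → ℕ} {K : ℕ} (hs : s 0 = 0)
    (hlt : ∀ k < K, s k < s (k + 1))
    (hblock : ∀ k < K, ∀ i j, s k ≤ i → i ≤ j → j < s (k + 1) → IterBounded g 1 (ν i) (ν j))
    (hstep : ∀ j < s K, IterBounded g 1 (ν j) (ν (j + 1))) :
    ∀ j ≤ s K, IterBounded g (2 * K) (ν 0) (ν j) := by
  induction K with
  | zero =>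
    intro j hj
    rw [hs, Nat.le_zero] at hj
    subst hj
    exact ⟨le_rfl, le_rfl⟩
  | succ K ih =>
    intro j hj
    have hK := hlt K K.lt_succ_self
    have hprev := ih (fun k hk => hlt k (hk.trans K.lt_succ_self))
      (fun k hk => hblock k (hk.trans K.lt_succ_self)) fun j hj => hstep j (hj.trans hK)
    have hin : ∀ j, s K ≤ j → j < s (K + 1) → IterBounded g (2 * K + 1) (ν 0) (ν j) :=
      fun j h₁ h₂ => (hprev _ le_rfl).trans hg (hblock K K.lt_succ_self _ _ le_rfl h₁ h₂)
    rcases le_total j (s K) with hjK | hjK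
    · exact (hprev j hjK).mono hid (by omega)
    rcases hj.lt_or_eq with hj | rfl
    · exact (hin j hjK hj).mono hid (by omega)
    · obtain ⟨i, hi⟩ := Nat.exists_eq_succ_of_ne_zero (Nat.ne_zero_of_lt hK)
      rw [hi] at hK hin ⊢
      have := (hin i (Nat.lt_succ_iff.1 hK) i.lt_succ_self).trans hg (hstep i (by omega))
      exact this

end IterBounded

/-- Bounds the size of a splitting scheme of total mass at most `A` after it has moved within one
quadrant, in terms of its size before. -/
noncomputable def growth (P Q : ℝ) (A K : ℝ≥0) : ℝ≥0 := K + A * K ^ (P - 1) + A * K ^ (Q - 1)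

theorem growth_comm (P Q : ℝ) (A : ℝ≥0) : growth P Q A = growth Q P A :=
  funext fun _ => add_right_comm _ _ _

theorem id_le_growth (P Q : ℝ) (A : ℝ≥0) : id ≤ growth P Q A := fun K => by
  rw [growth, add_assoc]
  exact le_self_add

theorem monotone_growth {P Q : ℝ} (hP : 1 < P) (hQ : 1 < Q) (A : ℝ≥0) : Monotone (growth P Q A) :=
  fun K K' h => by
    unfold growth
    gcongr

theorem nnnorm_add_mul_signedPow_le_growth {P : ℝ} (hP : 1 < P) (Q : ℝ) {A K : ℝ≥0} {S x y : ℝ}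
    (hS : ‖S‖₊ ≤ A) (hx : ‖x‖₊ ≤ K) (hy : ‖y‖₊ ≤ K) :
    ‖x + S * signedPow P y‖₊ ≤ growth P Q A K := by
  have hpow : ‖signedPow P y‖₊ = ‖y‖₊ ^ (P - 1) := NNReal.eq <| by
    rw [coe_nnnorm, Real.norm_eq_abs, abs_signedPow, signedPow_of_nonneg hP (abs_nonneg y),
      NNReal.coe_rpow, coe_nnnorm, Real.norm_eq_abs]
  calc ‖x + S * signedPow P y‖₊ ≤ ‖x‖₊ + ‖S‖₊ * ‖y‖₊ ^ (P - 1) := by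
        rw [← hpow, ← nnnorm_mul]
        exact nnnorm_add_le _ _
    _ ≤ K + A * K ^ (P - 1) := by gcongr
    _ ≤ growth P Q A K := le_self_add

/-- The sup norm of the planar sequence `(F, G)`. -/
def size (F G : ℕ → ℝ) (j : ℕ) : ℝ≥0 := max ‖F j‖₊ ‖G j‖₊

theorem size_rotate (F G : ℕ → ℝ) : size (-G) F = size F G := funext fun j => by
  rw [size, size, Pi.neg_apply, nnnorm_neg, max_comm]

namespace IsKick

variable {P Q : ℝ} {m l F G : ℕ → ℝ}

theorem iterBounded_size_of_inQuadrant (h : IsKick P Q m l F G) (hP : 1 < P) (hQ : 1 < Q)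
    {k i j : ℕ} (hij : i ≤ j) (hquad : ∀ x, i ≤ x → x ≤ j → InQuadrant k (F x) (G x)) {A : ℝ≥0}
    (hm : ∑ x ∈ Finset.Ico i j, m x ≤ A) (hl : ∑ x ∈ Finset.Ico i j, l x ≤ A) :
    IterBounded (growth P Q A) 1 (size F G i) (size F G j) := by
  induction k generalizing P Q m l F G with
  | zero =>
    have hnorm : ∀ {f : ℕ → ℝ}, (∀ x, 0 ≤ f x) → ∑ x ∈ Finset.Ico i j, f x ≤ A →
        ‖∑ x ∈ Finset.Ico i j, f x‖₊ ≤ A := fun {f} hf hfA => by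
      rwa [← NNReal.coe_le_coe, coe_nnnorm, Real.norm_of_nonneg (Finset.sum_nonneg fun x _ => hf x)]
    have hmA := hnorm h.fst_mass_nonneg hm
    have hlA := hnorm h.snd_mass_nonneg hl
    obtain ⟨hFi, hGi⟩ := hquad i le_rfl hij
    obtain ⟨hFj, hGj⟩ := hquad j hij le_rfl
    have hle : ∀ {x y : ℝ}, 0 ≤ x → x ≤ y → ‖x‖₊ ≤ ‖y‖₊ := fun hx hxy =>
      NNReal.coe_le_coe.1 (by simpa [abs_of_nonneg hx] using hxy.trans (le_abs_self _))
    have hF := hle hFi (h.fst_le_of_snd_nonneg hij fun x h₁ h₂ => (hquad x h₁ h₂.le).2)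
    have hG := hle hGj (h.snd_le_of_fst_nonneg hij fun x h₁ h₂ => (hquad x h₁ h₂.le).1)
    have hF' := hle hFj (sub_le_iff_le_add'.1 (h.fst_sub_mem_Icc_of_nonneg hP hij hquad).2)
    have hG' := hle hGi (sub_le_iff_le_add'.1 (h.snd_sub_mem_Icc_of_nonneg hQ hij hquad).2)
    refine ⟨max_le ?_ ?_, max_le ?_ ?_⟩
    · exact (hF.trans (le_max_left _ _)).trans (id_le_growth P Q A _)
    · rw [growth_comm]
      exact hG'.trans (nnnorm_add_mul_signedPow_le_growth hQ P hlA (le_max_right _ _)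
        (le_max_left _ _))
    · exact hF'.trans (nnnorm_add_mul_signedPow_le_growth hP Q hmA (le_max_left _ _)
        (le_max_right _ _))
    · exact (hG.trans (le_max_right _ _)).trans (id_le_growth P Q A _)
  | succ k ih =>
    have := ih h.rotate hQ hP hquad hl hm
    rwa [size_rotate, growth_comm] at this

theorem iterBounded_size_succ (h : IsKick P Q m l F G) (hP : 1 < P) (hQ : 1 < Q) {A : ℝ≥0} {j : ℕ}
    (hm : m j ≤ A) (hl : l j ≤ A) :
    IterBounded (growth P Q A) 1 (size F G j) (size F G (j + 1)) := by
  have hmA : ‖m j‖₊ ≤ A := NNReal.coe_le_coe.1 (by simpa [abs_of_nonneg (h.fst_mass_nonneg j)])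
  have hlA : ‖l j‖₊ ≤ A := NNReal.coe_le_coe.1 (by simpa [abs_of_nonneg (h.snd_mass_nonneg j)])
  have hF : F j = F (j + 1) + -m j * signedPow P (G (j + 1)) := by
    rw [h.fst_succ, h.snd_succ]
    rcases mul_eq_zero.1 (h.mass_mul_mass j) with h₀ | h₀ <;> simp [h₀]
  have hG : G j = G (j + 1) + l j * signedPow Q (F (j + 1)) := by
    rw [h.fst_succ, h.snd_succ]
    rcases mul_eq_zero.1 (h.mass_mul_mass j) with h₀ | h₀ <;> simp [h₀]
  refine ⟨max_le ?_ ?_, max_le ?_ ?_⟩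
  · rw [hF]
    exact nnnorm_add_mul_signedPow_le_growth hP Q (by rwa [nnnorm_neg]) (le_max_left _ _)
      (le_max_right _ _)
  · rw [hG, growth_comm]
    exact nnnorm_add_mul_signedPow_le_growth hQ P hlA (le_max_right _ _) (le_max_left _ _)
  · rw [h.fst_succ]
    exact nnnorm_add_mul_signedPow_le_growth hP Q hmA (le_max_left _ _) (le_max_right _ _)
  · rw [h.snd_succ, sub_eq_add_neg, ← neg_mul, growth_comm]
    exact nnnorm_add_mul_signedPow_le_growth hQ P (by rwa [nnnorm_neg]) (le_max_right _ _)
      (le_max_left _ _)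

theorem size_le_growth (h : IsKick P Q m l F G) {n L : ℕ} {s : ℕ → ℕ} (hw : IsWinding n L s F G)
    (hP : 1 < P) (hQ : 1 < Q) {A : ℝ≥0} (hm : ∑ j ∈ Finset.range L, m j ≤ A)
    (hl : ∑ j ∈ Finset.range L, l j ≤ A) {M j : ℕ} (hM : M ≤ L) (hj : j ≤ L) :
    size F G j ≤ (growth P Q A)^[2 * (2 * n + 1) + 2 * (2 * n + 1)] (size F G M) := by
  have hpart : ∀ {f : ℕ → ℝ}, (∀ j, 0 ≤ f j) → ∑ j ∈ Finset.range L, f j ≤ A → ∀ i j, j ≤ L →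
      ∑ x ∈ Finset.Ico i j, f x ≤ A := fun hf hfA i j hj =>
    (Finset.sum_le_sum_of_subset_of_nonneg
      (Finset.range_eq_Ico L ▸ Finset.Ico_subset_Ico i.zero_le hj) fun x _ _ => hf x).trans hfA
  have hmA := hpart h.fst_mass_nonneg hm
  have hlA := hpart h.snd_mass_nonneg hl
  have hsL : ∀ k < 2 * n + 1, s (k + 1) ≤ L := fun k hk => hw.le_last hk
  have key := IterBounded.of_blocks (monotone_growth hP hQ A) (id_le_growth P Q A) hw.start
    (fun k hk => hw.lt k (Nat.lt_succ_iff.1 hk))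
    (fun k hk i j hi hij hj => h.iterBounded_size_of_inQuadrant hP hQ hij
      (fun x h₁ h₂ => hw.mem k (Nat.lt_succ_iff.1 hk) x (hi.trans h₁) (h₂.trans_lt hj))
      (hmA i j (hj.le.trans (hsL k hk))) (hlA i j (hj.le.trans (hsL k hk))))
    fun j hj => h.iterBounded_size_succ hP hQ
      (by simpa using hmA j (j + 1) (hw.last ▸ hj)) (by simpa using hlA j (j + 1) (hw.last ▸ hj))
  rw [hw.last] at key
  exact ((key M hM).symm.trans (monotone_growth hP hQ A) (key j hj)).2

end IsKick

/-! ### Normalisation of winding sequences -/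

theorem IsKick.rescale {P Q : ℝ} {m l F G : ℕ → ℝ} (h : IsKick P Q m l F G) {r s : ℝ} (hr : 0 < r)
    (hs : 0 < s) : IsKick P Q (fun j => signedPow P s / r * m j)
      (fun j => signedPow Q r / s * l j) (fun j => r⁻¹ * F j) (fun j => s⁻¹ * G j) where
  fst_mass_nonneg j := mul_nonneg (div_pos (signedPow_pos hs) hr).le (h.fst_mass_nonneg j)
  snd_mass_nonneg j := mul_nonneg (div_pos (signedPow_pos hr) hs).le (h.snd_mass_nonneg j)
  mass_mul_mass j := by rw [mul_mul_mul_comm, h.mass_mul_mass, mul_zero]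
  fst_succ j := by
    have hpow : signedPow P (G j) = signedPow P s * signedPow P (s⁻¹ * G j) := by
      rw [← signedPow_mul, mul_inv_cancel_left₀ hs.ne']
    rw [h.fst_succ, hpow]
    ring
  snd_succ j := by
    have hpow : signedPow Q (F j) = signedPow Q r * signedPow Q (r⁻¹ * F j) := by
      rw [← signedPow_mul, mul_inv_cancel_left₀ hr.ne']
    rw [h.snd_succ, hpow]
    ring

theorem IsWinding.rescale {n L : ℕ} {s : ℕ → ℕ} {F G : ℕ → ℝ} (h : IsWinding n L s F G)
    {r t : ℝ} (hr : 0 < r) (ht : 0 < t) :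
    IsWinding n L s (fun j => r⁻¹ * F j) (fun j => t⁻¹ * G j) where
  fst_zero := by rw [h.fst_zero, mul_zero]
  snd_last := by rw [h.snd_last, mul_zero]
  ne_zero j hj := by
    obtain ⟨hG, hF⟩ := Complex.ext_iff.1 hj
    exact h.ne_zero j (Complex.ext ((mul_eq_zero_iff_left (inv_ne_zero ht.ne')).1 hG)
      ((mul_eq_zero_iff_left (inv_ne_zero hr.ne')).1 hF))
  start := h.start
  last := h.last
  lt := h.lt
  mem k hk j h₁ h₂ := (h.mem k hk j h₁ h₂).scale (inv_nonneg.2 hr.le) (inv_nonneg.2 ht.le)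

/-- Every stretch of at least about an `n`-th part of the `2N` indices carries mass at least
`μ`. -/
def IsSpread (n N : ℕ) (μ : ℝ) (m : ℕ → ℝ) : Prop :=
  ∀ i j, i ≤ j → j ≤ 2 * N → N ≤ (2 * n + 1) * (j - i + 1) → μ ≤ ∑ x ∈ Finset.Ico i j, m x

theorem IsKick.exists_mid {P Q c μ : ℝ} {m l F G : ℕ → ℝ} {n N : ℕ} {s : ℕ → ℕ}
    (h : IsKick P Q (fun j => c * m j) l F G) (hw : IsWinding n (2 * N) s F G) (hP : 1 < P)
    (hQ : 1 < Q) (hc : 0 ≤ c) (hm : IsSpread n N μ m) (hl : IsSpread n N μ l) :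
    ∃ M ≤ 2 * N, c * μ * signedPow P |G M| ≤ |F M| ∧ μ * signedPow Q |F M| ≤ |G M| := by
  obtain ⟨k, hk, hlong⟩ := hw.exists_long_block
  have hlast : s (k + 1) ≤ 2 * N := hw.le_last (Nat.succ_le_succ hk)
  have hlt := hw.lt k hk
  obtain ⟨D, hD⟩ := Nat.exists_eq_add_of_le hlt.le
  rw [hD, Nat.add_sub_cancel_left] at hlong
  have hhalf : ∀ d, D ≤ 2 * (d + 1) → N ≤ (2 * n + 1) * (d + 1) := fun d hd => by
    have := Nat.mul_le_mul_left (2 * n + 1) hd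
    rw [mul_left_comm] at this
    omega
  have hleft : N ≤ (2 * n + 1) * (s k + D / 2 - s k + 1) := hhalf _ (by omega)
  have hright : N ≤ (2 * n + 1) * (s k + D - 1 - (s k + D / 2) + 1) := hhalf _ (by omega)
  refine ⟨s k + D / 2, by omega, h.mid_bounds hP hQ (k := k) (i := s k) (j := s k + D - 1)
    (by omega) (by omega) (fun x h₁ h₂ => hw.mem k hk x h₁ (by omega)) ?_ ?_ ?_ ?_⟩
  · rw [← Finset.mul_sum]
    exact mul_le_mul_of_nonneg_left (hm _ _ (by omega) (by omega) hleft) hc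
  · rw [← Finset.mul_sum]
    exact mul_le_mul_of_nonneg_left (hm _ _ (by omega) (by omega) hright) hc
  · exact hl _ _ (by omega) (by omega) hleft
  · exact hl _ _ (by omega) (by omega) hright

theorem IsAlternating.exists_normalised_isWinding {P Q : ℝ} {m l : ℕ → ℝ} (h : IsAlternating m l)
    (hP : 1 < P) (hQ : 1 < Q) {n N : ℕ} (hN : n < N) {μ : ℝ} (hμ : 0 < μ) (hm : IsSpread n N μ m)
    (hl : IsSpread n N μ l) :
    ∃ c₁ ∈ Set.Icc 0 μ⁻¹, ∃ c₂ ∈ Set.Icc 0 μ⁻¹, ∃ (F G : ℕ → ℝ) (s : ℕ → ℕ),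
      IsKick P Q (fun j => c₁ * m j) (fun j => c₂ * l j) F G ∧ IsWinding n (2 * N) s F G ∧
      ∃ M ≤ 2 * N, |F M| = 1 ∧ |G M| = 1 := by
  obtain ⟨c, hc, F, G, s, hkick, hw⟩ := h.exists_isWinding hP hQ hN
  obtain ⟨M, hM, hF, hG⟩ := hkick.exists_mid hw hP hQ hc.le hm hl
  have hFM : 0 < |F M| := by
    rcases eq_or_ne (G M) 0 with hG0 | hG0
    · exact abs_pos.2 fun hF0 => hw.ne_zero M (Complex.ext hG0 hF0)
    · exact (mul_pos (mul_pos hc hμ) (signedPow_pos (abs_pos.2 hG0))).trans_le hF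
  have hGM : 0 < |G M| := (mul_pos hμ (signedPow_pos hFM)).trans_le hG
  have hone : ∀ x : ℝ, 0 < |x| → |(|x|)⁻¹ * x| = 1 := fun x hx => by
    rw [abs_mul, abs_inv, abs_abs, inv_mul_cancel₀ hx.ne']
  refine ⟨signedPow P |G M| / |F M| * c, ⟨?_, ?_⟩, signedPow Q |F M| / |G M|, ⟨?_, ?_⟩, _, _, s,
    ?_, hw.rescale hFM hGM, M, hM, hone _ hFM, hone _ hGM⟩
  · exact mul_nonneg (div_pos (signedPow_pos hGM) hFM).le hc.le
  · rw [div_mul_eq_mul_div, div_le_iff₀ hFM, ← div_eq_inv_mul, le_div_iff₀ hμ]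
    linarith
  · exact (div_pos (signedPow_pos hFM) hGM).le
  · rw [div_le_iff₀ hGM, ← div_eq_inv_mul, le_div_iff₀ hμ]
    linarith
  · simpa only [mul_assoc] using hkick.rescale hFM hGM

theorem IsAlternating.exists_bounded_isWinding {P Q : ℝ} {m l : ℕ → ℝ} (h : IsAlternating m l)
    (hP : 1 < P) (hQ : 1 < Q) {n N : ℕ} (hN : n < N) {A μ : ℝ≥0} (hμ : 0 < μ)
    (hm : IsSpread n N μ m) (hl : IsSpread n N μ l) (hmA : ∑ j ∈ Finset.range (2 * N), m j ≤ A)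
    (hlA : ∑ j ∈ Finset.range (2 * N), l j ≤ A) :
    ∃ c₁ ∈ Set.Icc (0 : ℝ) μ⁻¹, ∃ c₂ ∈ Set.Icc (0 : ℝ) μ⁻¹, ∃ (F G : ℕ → ℝ) (s : ℕ → ℕ),
      IsKick P Q (fun j => c₁ * m j) (fun j => c₂ * l j) F G ∧ IsWinding n (2 * N) s F G ∧
      (∃ M ≤ 2 * N, |F M| = 1 ∧ |G M| = 1) ∧ ∀ j ≤ 2 * N, size F G j ≤
        (growth P Q (μ⁻¹ * A))^[2 * (2 * n + 1) + 2 * (2 * n + 1)] 1 := by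
  obtain ⟨c₁, hc₁, c₂, hc₂, F, G, s, hkick, hw, M, hM, hF, hG⟩ :=
    h.exists_normalised_isWinding hP hQ hN (NNReal.coe_pos.2 hμ) hm hl
  have hsize : size F G M = 1 := NNReal.eq <| by
    simp only [size, NNReal.coe_max, coe_nnnorm, Real.norm_eq_abs, hF, hG, max_self,
      NNReal.coe_one]
  have hmass : ∀ {c : ℝ} {f : ℕ → ℝ}, c ∈ Set.Icc (0 : ℝ) μ⁻¹ →
      ∑ j ∈ Finset.range (2 * N), f j ≤ A →
      ∑ j ∈ Finset.range (2 * N), c * f j ≤ (μ⁻¹ * A : ℝ≥0) := fun {c f} hc hf => by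
    rw [← Finset.mul_sum]
    push_cast
    exact (mul_le_mul_of_nonneg_left hf hc.1).trans (mul_le_mul_of_nonneg_right hc.2 A.2)
  exact ⟨c₁, hc₁, c₂, hc₂, F, G, s, hkick, hw, ⟨M, hM, hF, hG⟩, fun j hj =>
    hsize ▸ hkick.size_le_growth hw hP hQ (hmass hc₁ hmA) (hmass hc₂ hlA) hM hj⟩

/-! ### Discretisation of weights -/

/-- A positive weight on the line, integrable over bounded intervals. -/
structure IsWeight (U : ℝ → ℝ) : Prop where
  pos : ∀ x, 0 < U x
  int : ∀ x y, IntervalIntegrable U volume x y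

namespace IsWeight

variable {U : ℝ → ℝ}

theorem integral_pos (hU : IsWeight U) {x y : ℝ} (h : x < y) : 0 < ∫ t in x..y, U t :=
  intervalIntegral.intervalIntegral_pos_of_pos (hU.int x y) hU.pos h

theorem integral_nonneg (hU : IsWeight U) {x y : ℝ} (h : x ≤ y) : 0 ≤ ∫ t in x..y, U t :=
  intervalIntegral.integral_nonneg h fun t _ => (hU.pos t).le

theorem integral_mono (hU : IsWeight U) {w x y z : ℝ} (hwx : w ≤ x) (hyz : y ≤ z) :
    ∫ t in x..y, U t ≤ ∫ t in w..z, U t := by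
  have h₁ := intervalIntegral.integral_add_adjacent_intervals (hU.int w x) (hU.int x y)
  have h₂ := intervalIntegral.integral_add_adjacent_intervals (hU.int w y) (hU.int y z)
  linarith [hU.integral_nonneg hwx, hU.integral_nonneg hyz]

theorem exists_pos_le_integral (hU : IsWeight U) {a b δ : ℝ} (hab : a ≤ b) (hδ : 0 < δ) :
    ∃ μ > 0, ∀ x y, a ≤ x → y ≤ b → x + δ ≤ y → μ ≤ ∫ t in x..y, U t := by
  have hprim := intervalIntegral.continuous_primitive hU.int a
  have hcont : Continuous fun x => ∫ t in x..x + δ, U t := by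
    refine ((hprim.comp (continuous_add_const δ)).sub hprim).congr fun x => ?_
    exact intervalIntegral.integral_interval_sub_left (hU.int _ _) (hU.int _ _)
  obtain ⟨x₀, -, hx₀⟩ := isCompact_Icc.exists_isMinOn (Set.nonempty_Icc.2 hab) hcont.continuousOn
  refine ⟨_, hU.integral_pos (lt_add_of_pos_right x₀ hδ), fun x y hx hy hxy => ?_⟩
  exact (hx₀ (Set.mem_Icc.2 ⟨hx, by linarith⟩)).trans (hU.integral_mono le_rfl hxy)

theorem int_mul (hU : IsWeight U) {h : ℝ → ℝ} (hh : Measurable h) {C : ℝ} (hC : ∀ t, |h t| ≤ C)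
    (x y : ℝ) : IntervalIntegrable (fun t => h t * U t) volume x y :=
  ⟨(hU.int x y).1.bdd_mul hh.aestronglyMeasurable (.of_forall hC),
    (hU.int x y).2.bdd_mul hh.aestronglyMeasurable (.of_forall hC)⟩

theorem abs_integral_mul_le (hU : IsWeight U) {h : ℝ → ℝ} {C : ℝ} (hC : ∀ t, |h t| ≤ C)
    (x y : ℝ) : |∫ t in x..y, h t * U t| ≤ C * |∫ t in x..y, U t| := by
  wlog hxy : x ≤ y generalizing x y
  · have := this y x (le_of_not_ge hxy)
    rwa [intervalIntegral.integral_symm x y, abs_neg, intervalIntegral.integral_symm x y,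
      abs_neg] at this
  rw [abs_of_nonneg (hU.integral_nonneg hxy), ← intervalIntegral.integral_const_mul,
    ← Real.norm_eq_abs]
  refine intervalIntegral.norm_integral_le_of_norm_le hxy (.of_forall fun t _ => ?_)
    ((hU.int x y).const_mul C)
  rw [Real.norm_eq_abs, abs_mul, abs_of_pos (hU.pos t)]
  exact mul_le_mul_of_nonneg_right (hC t) (hU.pos t).le

end IsWeight

/-- The nodes of the uniform subdivision of `[a, b]` into `N` cells. -/
noncomputable def node (a b : ℝ) (N i : ℕ) : ℝ := a + (b - a) * (i / N)

/-- The mass of a weight on a cell of the uniform subdivision. -/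
noncomputable def cellMass (U : ℝ → ℝ) (a b : ℝ) (N i : ℕ) : ℝ :=
  ∫ t in node a b N i..node a b N (i + 1), U t

/-- The index of the cell that contains `t`. The minimum makes `b` belong to the last cell. -/
noncomputable def cell (a b : ℝ) (N : ℕ) (t : ℝ) : ℕ := min (N - 1) ⌊(t - a) / (b - a) * N⌋₊

section node

variable {a b : ℝ} {N : ℕ}

theorem node_zero : node a b N 0 = a := by simp [node]

theorem node_self (hN : 0 < N) : node a b N N = b := by
  rw [node, div_self (by positivity), mul_one, add_sub_cancel]

theorem node_sub_node (i j : ℕ) : node a b N j - node a b N i = (b - a) * ((j - i) / N) := by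
  rw [node, node]; ring

theorem strictMono_node (hab : a < b) (hN : 0 < N) : StrictMono (node a b N) := fun i j hij => by
  have hN' : (0 : ℝ) < N := Nat.cast_pos.2 hN
  rw [← sub_pos, node_sub_node]
  exact mul_pos (sub_pos.2 hab) (div_pos (sub_pos.2 (Nat.cast_lt.2 hij)) hN')

theorem node_mem_Icc (hab : a < b) (hN : 0 < N) {i : ℕ} (hi : i ≤ N) :
    node a b N i ∈ Set.Icc a b :=
  have hmono := (strictMono_node hab hN).monotone
  ⟨node_zero.symm.trans_le (hmono i.zero_le), (hmono hi).trans_eq (node_self hN)⟩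

theorem measurable_comp_cell (h : ℕ → ℝ) : Measurable fun t => h (cell a b N t) := by
  have hcell : Measurable (cell a b N) :=
    measurable_const.min (Nat.measurable_floor.comp (by fun_prop))
  exact (measurable_from_nat (f := h)).comp hcell

theorem cell_lt (hN : 0 < N) (t : ℝ) : cell a b N t < N :=
  (min_le_left _ _).trans_lt (by omega)

theorem cell_eq (hab : a < b) {i : ℕ} (hi : i < N) {t : ℝ}
    (ht : t ∈ Set.Ico (node a b N i) (node a b N (i + 1))) : cell a b N t = i := by
  have hba : 0 < b - a := sub_pos.2 hab
  have hN : (0 : ℝ) < N := Nat.cast_pos.2 (by omega)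
  have h₁ : (i : ℝ) ≤ (t - a) / (b - a) * N := by
    rw [← div_le_iff₀ hN, le_div_iff₀' hba]
    exact le_sub_iff_add_le'.2 ht.1
  have h₂ : (t - a) / (b - a) * N < i + 1 := by
    rw [← lt_div_iff₀ hN, div_lt_iff₀' hba, ← Nat.cast_add_one]
    exact sub_lt_iff_lt_add'.2 ht.2
  rw [cell, (Nat.floor_eq_iff ((Nat.cast_nonneg i).trans h₁)).2 ⟨h₁, h₂⟩]
  exact min_eq_right (by omega)

theorem mem_Icc_node_cell (hab : a < b) (hN : 0 < N) {t : ℝ} (ht : t ∈ Set.Icc a b) :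
    t ∈ Set.Icc (node a b N (cell a b N t)) (node a b N (cell a b N t + 1)) := by
  have hba : 0 < b - a := sub_pos.2 hab
  have hN' : (0 : ℝ) < N := Nat.cast_pos.2 hN
  have h₀ : 0 ≤ (t - a) / (b - a) * N :=
    mul_nonneg (div_nonneg (sub_nonneg.2 ht.1) hba.le) hN'.le
  have hle : (t - a) / (b - a) * N ≤ N :=
    mul_le_of_le_one_left hN'.le ((div_le_one hba).2 (sub_le_sub_right ht.2 a))
  have hnode : t = a + (b - a) * ((t - a) / (b - a) * N / N) := by field_simp; ring
  have hlow : (cell a b N t : ℝ) ≤ (t - a) / (b - a) * N :=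
    (Nat.cast_le.2 (min_le_right _ _)).trans (Nat.floor_le h₀)
  have hhigh : (t - a) / (b - a) * N ≤ (cell a b N t + 1 : ℕ) := by
    rcases le_total (N - 1) ⌊(t - a) / (b - a) * N⌋₊ with h | h
    · rwa [cell, min_eq_left h, Nat.sub_add_cancel hN]
    · rw [cell, min_eq_right h, Nat.cast_add_one]
      exact (Nat.lt_floor_add_one _).le
  constructor
  · conv_rhs => rw [hnode]
    unfold node
    gcongr
  · conv_lhs => rw [hnode]
    unfold node
    gcongr

end node

namespace IsWeight

variable {a b : ℝ} {N : ℕ} {U : ℝ → ℝ}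

theorem cellMass_pos (hU : IsWeight U) (hab : a < b) (hN : 0 < N) (i : ℕ) :
    0 < cellMass U a b N i :=
  hU.integral_pos (strictMono_node hab hN i.lt_succ_self)

theorem sum_cellMass (hU : IsWeight U) (I : ℕ) :
    ∑ i ∈ Finset.range I, cellMass U a b N i = ∫ t in a..node a b N I, U t := by
  simpa only [node_zero, cellMass] using
    intervalIntegral.sum_integral_adjacent_intervals (a := node a b N) fun k _ => hU.int _ _

theorem integral_comp_cell (hU : IsWeight U) (hab : a < b) (h : ℕ → ℝ) {I : ℕ} (hI : I ≤ N) :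
    ∫ t in a..node a b N I, h (cell a b N t) * U t =
      ∑ i ∈ Finset.range I, cellMass U a b N i * h i := by
  rcases N.eq_zero_or_pos with rfl | hN
  · simp [Nat.le_zero.1 hI, node_zero]
  have hbound : ∀ t, |h (cell a b N t)| ≤ ∑ i ∈ Finset.range N, |h i| := fun t =>
    Finset.single_le_sum (f := fun i => |h i|) (fun _ _ => abs_nonneg _)
      (Finset.mem_range.2 (cell_lt hN t))
  have hsum := intervalIntegral.sum_integral_adjacent_intervals (a := node a b N) (n := I)
    fun k _ => hU.int_mul (measurable_comp_cell h) hbound _ _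
  rw [node_zero] at hsum
  rw [← hsum]
  refine Finset.sum_congr rfl fun i hi => ?_
  rw [cellMass, mul_comm, ← intervalIntegral.integral_const_mul]
  refine intervalIntegral.integral_congr_Ioo_of_le
    ((strictMono_node hab hN).monotone i.le_succ) fun t ht => ?_
  simp only [cell_eq hab ((Finset.mem_range.1 hi).trans_le hI) (Set.Ioo_subset_Ico_self ht)]

end IsWeight

/-- The sequence `μ 0, 0, μ 1, 0, …`. -/
def atEven (μ : ℕ → ℝ) (j : ℕ) : ℝ := if Even j then μ (j / 2) else 0

/-- The sequence `0, μ 0, 0, μ 1, …`. -/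
def atOdd (μ : ℕ → ℝ) (j : ℕ) : ℝ := if Even j then 0 else μ (j / 2)

theorem isAlternating_atEven_atOdd {μ ν : ℕ → ℝ} (hμ : ∀ k, 0 < μ k) (hν : ∀ k, 0 < ν k) :
    IsAlternating (atEven μ) (atOdd ν) where
  fst_even k := by simpa [atEven] using hμ k
  fst_odd k := by simp [atEven]
  snd_even k := by simp [atOdd]
  snd_odd k := by simpa [atOdd] using hν _

theorem sum_atEven_mul (μ h : ℕ → ℝ) (J : ℕ) : ∑ j ∈ Finset.range J, atEven μ j * h j =
    ∑ i ∈ Finset.range ((J + 1) / 2), μ i * h (2 * i) := by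
  induction J with
  | zero => simp
  | succ J ih =>
    rw [Finset.sum_range_succ, ih]
    obtain ⟨i, rfl | rfl⟩ := J.even_or_odd'
    · rw [atEven, if_pos (even_two_mul i), show (2 * i + 1) / 2 = i by omega,
        show 2 * i / 2 = i by omega, show (2 * i + 1 + 1) / 2 = i + 1 by omega,
        Finset.sum_range_succ]
    · rw [atEven, if_neg (by simp), zero_mul, add_zero,
        show (2 * i + 1 + 1 + 1) / 2 = (2 * i + 1 + 1) / 2 by omega]

theorem sum_atOdd_mul (μ h : ℕ → ℝ) (J : ℕ) : ∑ j ∈ Finset.range J, atOdd μ j * h j =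
    ∑ i ∈ Finset.range (J / 2), μ i * h (2 * i + 1) := by
  induction J with
  | zero => simp
  | succ J ih =>
    rw [Finset.sum_range_succ, ih]
    obtain ⟨i, rfl | rfl⟩ := J.even_or_odd'
    · rw [atOdd, if_pos (even_two_mul i), zero_mul, add_zero,
        show (2 * i + 1) / 2 = 2 * i / 2 by omega]
    · rw [atOdd, if_neg (by simp), show (2 * i + 1) / 2 = i by omega,
        show (2 * i + 1 + 1) / 2 = i + 1 by omega, Finset.sum_range_succ]

namespace IsWeight

variable {a b : ℝ} {N : ℕ} {U : ℝ → ℝ}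

theorem sum_atEven (hU : IsWeight U) (J : ℕ) : ∑ j ∈ Finset.range J, atEven (cellMass U a b N) j =
    ∫ t in a..node a b N ((J + 1) / 2), U t := by
  simpa only [mul_one, hU.sum_cellMass] using sum_atEven_mul (cellMass U a b N) (fun _ => 1) J

theorem sum_atOdd (hU : IsWeight U) (J : ℕ) : ∑ j ∈ Finset.range J, atOdd (cellMass U a b N) j =
    ∫ t in a..node a b N (J / 2), U t := by
  simpa only [mul_one, hU.sum_cellMass] using sum_atOdd_mul (cellMass U a b N) (fun _ => 1) J

theorem isSpread {n : ℕ} {μ : ℝ} {m : ℕ → ℝ} {r : ℕ → ℕ} (hU : IsWeight U) (hab : a < b)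
    (hN : 4 * (2 * n + 1) ≤ N)
    (hμ : ∀ x y, a ≤ x → y ≤ b → x + (b - a) / (4 * (2 * n + 1)) ≤ y → μ ≤ ∫ t in x..y, U t)
    (hr : ∀ i j, i ≤ j → r i ≤ r j ∧ j ≤ i + 2 * (r j - r i) + 1) (hrN : r (2 * N) = N)
    (hm : ∀ J, ∑ j ∈ Finset.range J, m j = ∫ t in a..node a b N (r J), U t) :
    IsSpread n N μ m := fun i j hij hj hlen => by
  have hN0 : 0 < N := by omega
  obtain ⟨hrij, hgap⟩ := hr i j hij
  have hrj : r j ≤ N := (hr j _ hj).1.trans_eq hrN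
  rw [Finset.sum_Ico_eq_sub _ hij, hm, hm,
    intervalIntegral.integral_interval_sub_left (hU.int _ _) (hU.int _ _)]
  refine hμ _ _ (node_mem_Icc hab hN0 (hrij.trans hrj)).1 (node_mem_Icc hab hN0 hrj).2 ?_
  obtain ⟨d, hd⟩ := Nat.exists_eq_add_of_le hrij
  have hfine : N ≤ 4 * (2 * n + 1) * d := by
    have := Nat.mul_le_mul_left (2 * n + 1) (show j - i + 1 ≤ 2 * (d + 1) by omega)
    nlinarith
  have hstep : 1 / (4 * (2 * (n : ℝ) + 1)) ≤ d / N := by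
    rw [div_le_div_iff₀ (by positivity) (by positivity)]
    exact_mod_cast (one_mul N).trans_le (hfine.trans_eq (mul_comm _ _))
  rw [← le_sub_iff_add_le', node_sub_node, hd, Nat.cast_add, add_sub_cancel_left,
    div_eq_mul_one_div]
  exact mul_le_mul_of_nonneg_left hstep (sub_pos.2 hab).le

end IsWeight

/-! ### Discrete solutions -/

/-- A winding solution, with multipliers `c₁, c₂` and normalised at some index, of the splitting
scheme on the subdivision of `[a, b]` into `N` cells, where each cell carries first its mass of `U`
and then its mass of `V`. -/
structure DiscreteSolution (P Q a b : ℝ) (U V : ℝ → ℝ) (n : ℕ) (C : ℝ) where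
  N : ℕ
  N_pos : 0 < N
  c₁ : ℝ
  c₂ : ℝ
  F : ℕ → ℝ
  G : ℕ → ℝ
  s : ℕ → ℕ
  mid : ℕ
  c₁_mem : c₁ ∈ Set.Icc 0 C
  c₂_mem : c₂ ∈ Set.Icc 0 C
  isKick : IsKick P Q (fun j => c₁ * atEven (cellMass U a b N) j)
    (fun j => c₂ * atOdd (cellMass V a b N) j) F G
  isWinding : IsWinding n (2 * N) s F G
  mid_le : mid ≤ 2 * N
  abs_F_mid : |F mid| = 1
  abs_G_mid : |G mid| = 1
  abs_F_le : ∀ j ≤ 2 * N, |F j| ≤ C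
  abs_G_le : ∀ j ≤ 2 * N, |G j| ≤ C

theorem exists_discreteSolution {P Q a b : ℝ} {U V : ℝ → ℝ} (hP : 1 < P) (hQ : 1 < Q) (hab : a < b)
    (hU : IsWeight U) (hV : IsWeight V) (n : ℕ) :
    ∃ (N₀ : ℕ) (C : ℝ), ∀ N ≥ N₀, ∃ D : DiscreteSolution P Q a b U V n C, D.N = N := by
  have hδ : 0 < (b - a) / (4 * (2 * n + 1)) := div_pos (sub_pos.2 hab) (by positivity)
  obtain ⟨μ₁, hμ₁, hUμ⟩ := hU.exists_pos_le_integral hab.le hδ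
  obtain ⟨μ₂, hμ₂, hVμ⟩ := hV.exists_pos_le_integral hab.le hδ
  lift μ₁ to ℝ≥0 using hμ₁.le
  lift μ₂ to ℝ≥0 using hμ₂.le
  obtain ⟨A, hUA, hVA⟩ : ∃ A : ℝ≥0, ∫ t in a..b, U t ≤ A ∧ ∫ t in a..b, V t ≤ A :=
    ⟨(max (∫ t in a..b, U t) (∫ t in a..b, V t)).toNNReal,
      (le_max_left _ _).trans (Real.le_coe_toNNReal _),
      (le_max_right _ _).trans (Real.le_coe_toNNReal _)⟩
  set μ := min μ₁ μ₂
  set B := (growth P Q (μ⁻¹ * A))^[2 * (2 * n + 1) + 2 * (2 * n + 1)] 1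
  refine ⟨4 * (2 * n + 1), (max μ⁻¹ B : ℝ≥0), fun N hN => ?_⟩
  have hN0 : 0 < N := by omega
  obtain ⟨c₁, hc₁, c₂, hc₂, F, G, s, hkick, hw, ⟨M, hM, hF, hG⟩, hsize⟩ :=
    (isAlternating_atEven_atOdd (hU.cellMass_pos hab hN0)
      (hV.cellMass_pos hab hN0)).exists_bounded_isWinding hP hQ (n := n) (by omega) (A := A)
      (μ := μ) (lt_min hμ₁ hμ₂)
      (hU.isSpread hab hN (fun x y hx hy h => (NNReal.coe_le_coe.2 (min_le_left _ _)).trans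
        (hUμ x y hx hy h)) (fun i j _ => by omega) (by omega) hU.sum_atEven)
      (hV.isSpread hab hN (fun x y hx hy h => (NNReal.coe_le_coe.2 (min_le_right _ _)).trans
        (hVμ x y hx hy h)) (fun i j _ => by omega) (by omega) hV.sum_atOdd)
      (by rwa [hU.sum_atEven, show (2 * N + 1) / 2 = N by omega, node_self hN0])
      (by rwa [hV.sum_atOdd, show 2 * N / 2 = N by omega, node_self hN0])
  have hC : Set.Icc 0 ((μ : ℝ)⁻¹) ⊆ Set.Icc 0 ((max μ⁻¹ B : ℝ≥0) : ℝ) :=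
    Set.Icc_subset_Icc_right ((NNReal.coe_inv μ).symm.trans_le
      (NNReal.coe_le_coe.2 (le_max_left _ _)))
  have hbound : ∀ j ≤ 2 * N, size F G j ≤ max μ⁻¹ B := fun j hj =>
    (hsize j hj).trans (le_max_right _ _)
  exact ⟨⟨N, hN0, c₁, c₂, F, G, s, M, hC hc₁, hC hc₂, hkick, hw, hM, hF, hG,
    fun j hj => NNReal.coe_le_coe.2 ((le_max_left _ _).trans (hbound j hj)),
    fun j hj => NNReal.coe_le_coe.2 ((le_max_right _ _).trans (hbound j hj))⟩, rfl⟩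

/-- The position on the line of the `j`-th state of a discrete solution. -/
noncomputable def DiscreteSolution.pos {P Q a b : ℝ} {U V : ℝ → ℝ} {n : ℕ} {C : ℝ}
    (D : DiscreteSolution P Q a b U V n C) (j : ℕ) : ℝ := node a b D.N (j / 2)

/-- The first component of a discrete solution, interpolated by a primitive. -/
noncomputable def DiscreteSolution.fst {P Q a b : ℝ} {U V : ℝ → ℝ} {n : ℕ} {C : ℝ}
    (D : DiscreteSolution P Q a b U V n C) (x : ℝ) : ℝ :=
  D.c₁ * ∫ t in a..x, signedPow P (D.G (2 * cell a b D.N t)) * U t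

/-- The second component of a discrete solution, interpolated by a primitive. -/
noncomputable def DiscreteSolution.snd {P Q a b : ℝ} {U V : ℝ → ℝ} {n : ℕ} {C : ℝ}
    (D : DiscreteSolution P Q a b U V n C) (x : ℝ) : ℝ :=
  D.G 0 - D.c₂ * ∫ t in a..x, signedPow Q (D.F (2 * cell a b D.N t + 1)) * V t

theorem abs_signedPow_le {P C x : ℝ} (hP : 1 < P) (h : |x| ≤ C) : |signedPow P x| ≤ signedPow P C :=
  (abs_signedPow P x).trans_le (signedPow_le_signedPow hP (abs_nonneg x) h)

theorem IsWeight.abs_mul_integral_signedPow_sub_le {P C c a : ℝ} {U w : ℝ → ℝ} (hU : IsWeight U)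
    (hP : 1 < P) (hc : c ∈ Set.Icc 0 C) (hw : Measurable w) (hwC : ∀ t, |w t| ≤ C) (x y : ℝ) :
    |(c * ∫ t in a..x, signedPow P (w t) * U t) - c * ∫ t in a..y, signedPow P (w t) * U t| ≤
      |(C * signedPow P C * ∫ t in a..x, U t) - C * signedPow P C * ∫ t in a..y, U t| := by
  have hbound : ∀ t, |signedPow P (w t)| ≤ signedPow P C := fun t => abs_signedPow_le hP (hwC t)
  have hint : ∀ x y, IntervalIntegrable (fun t => signedPow P (w t) * U t) volume x y :=
    hU.int_mul ((continuous_signedPow hP).measurable.comp hw) hbound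
  have hC : 0 ≤ C := hc.1.trans hc.2
  rw [← mul_sub, ← mul_sub, intervalIntegral.integral_interval_sub_left (hint _ _) (hint _ _),
    intervalIntegral.integral_interval_sub_left (hU.int _ _) (hU.int _ _), abs_mul, abs_mul,
    abs_of_nonneg hc.1, abs_of_nonneg (mul_nonneg hC (signedPow_nonneg hC)), mul_assoc]
  exact mul_le_mul hc.2 (hU.abs_integral_mul_le hbound y x) (abs_nonneg _) hC

namespace DiscreteSolution

variable {P Q a b : ℝ} {U V : ℝ → ℝ} {n : ℕ} {C : ℝ} (D : DiscreteSolution P Q a b U V n C)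

theorem fst_left : D.fst a = 0 := by simp [fst]

theorem snd_left : D.snd a = D.G 0 := by simp [snd]

theorem fst_pos (hab : a < b) (hU : IsWeight U) {j : ℕ} (hj : j ≤ 2 * D.N) :
    D.fst (D.pos (j + 1)) = D.F j := by
  have hsum := D.isKick.fst_eq_add_sum j.zero_le
  simp only [D.isWinding.fst_zero, zero_add, mul_assoc, ← Finset.mul_sum,
    Nat.Ico_zero_eq_range] at hsum
  rw [hsum, sum_atEven_mul _ (fun i => signedPow P (D.G i)), fst, pos,
    hU.integral_comp_cell hab (fun i => signedPow P (D.G (2 * i))) (by omega)]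

theorem snd_pos (hab : a < b) (hV : IsWeight V) {j : ℕ} (hj : j ≤ 2 * D.N) :
    D.snd (D.pos j) = D.G j := by
  have hsum := D.isKick.snd_eq_sub_sum j.zero_le
  simp only [mul_assoc, ← Finset.mul_sum, Nat.Ico_zero_eq_range] at hsum
  rw [hsum, sum_atOdd_mul _ (fun i => signedPow Q (D.F i)), snd, pos,
    hV.integral_comp_cell hab (fun i => signedPow Q (D.F (2 * i + 1))) (by omega)]

theorem two_mul_cell_lt (t : ℝ) : 2 * cell a b D.N t < 2 * D.N :=
  Nat.mul_lt_mul_of_pos_left (cell_lt D.N_pos t) two_pos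

theorem abs_F_cell_le (t : ℝ) : |D.F (2 * cell a b D.N t + 1)| ≤ C :=
  D.abs_F_le _ (D.two_mul_cell_lt t)

theorem abs_G_cell_le (t : ℝ) : |D.G (2 * cell a b D.N t)| ≤ C :=
  D.abs_G_le _ (D.two_mul_cell_lt t).le

theorem measurable_F_cell : Measurable fun t => D.F (2 * cell a b D.N t + 1) :=
  measurable_comp_cell fun i => D.F (2 * i + 1)

theorem measurable_G_cell : Measurable fun t => D.G (2 * cell a b D.N t) :=
  measurable_comp_cell fun i => D.G (2 * i)

theorem abs_fst_sub_fst_le (hP : 1 < P) (hU : IsWeight U) (x y : ℝ) : |D.fst x - D.fst y| ≤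
    |(C * signedPow P C * ∫ t in a..x, U t) - C * signedPow P C * ∫ t in a..y, U t| :=
  hU.abs_mul_integral_signedPow_sub_le hP D.c₁_mem D.measurable_G_cell D.abs_G_cell_le x y

theorem abs_snd_sub_snd_le (hQ : 1 < Q) (hV : IsWeight V) (x y : ℝ) : |D.snd x - D.snd y| ≤
    |(C * signedPow Q C * ∫ t in a..x, V t) - C * signedPow Q C * ∫ t in a..y, V t| := by
  rw [snd, snd, sub_sub_sub_cancel_left, abs_sub_comm]
  exact hV.abs_mul_integral_signedPow_sub_le hQ D.c₂_mem D.measurable_F_cell D.abs_F_cell_le x y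

theorem monotone_pos (hab : a < b) : Monotone D.pos :=
  (strictMono_node hab D.N_pos).monotone.comp fun _ _ h => Nat.div_le_div_right h

theorem pos_zero : D.pos 0 = a := node_zero

theorem pos_last : D.pos (2 * D.N) = b := by
  rw [pos, Nat.mul_div_cancel_left _ two_pos, node_self D.N_pos]

theorem pos_mem_Icc (hab : a < b) {j : ℕ} (hj : j ≤ 2 * D.N + 1) : D.pos j ∈ Set.Icc a b :=
  node_mem_Icc hab D.N_pos (by omega)

end DiscreteSolution

/-! ### Passage to the limit -/

theorem exists_tendstoUniformlyOn_subseq {a b C : ℝ} (hab : a ≤ b) {f : ℕ → ℝ → ℝ} {W : ℝ → ℝ}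
    (hW : Continuous W) (hC : ∀ ν, |f ν a| ≤ C)
    (hf : ∀ ν x y, |f ν x - f ν y| ≤ |W x - W y|) :
    ∃ (φ : ℕ → ℕ) (g : ℝ → ℝ), StrictMono φ ∧ Continuous g ∧
      TendstoUniformlyOn (fun ν => f (φ ν)) g atTop (Set.Icc a b) := by
  have hmod : ∀ x : Set.Icc a b, Tendsto (fun y : Set.Icc a b => |W x - W y|) (𝓝 x) (𝓝 0) :=
    fun x => by
      have : Continuous fun y : Set.Icc a b => |W x - W y| := by fun_prop
      simpa only [sub_self, abs_zero] using this.tendsto x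
  have hcont : ∀ ν, Continuous fun x : Set.Icc a b => f ν x := fun ν =>
    continuous_iff_continuousAt.2 fun x => tendsto_iff_dist_tendsto_zero.2 <|
      squeeze_zero (fun _ => dist_nonneg)
        (fun y => (dist_comm _ _).trans_le (hf ν x y)) (hmod x)
  obtain ⟨B, hB⟩ := isCompact_Icc.exists_bound_of_continuousOn (s := Set.Icc a b)
    (hW.sub continuous_const : Continuous fun x => W x - W a).continuousOn
  have hbound : ∀ ν, ∀ x ∈ Set.Icc a b, |f ν x| ≤ C + B := fun ν x hx => by
    have hWx : |W x - W a| ≤ B := hB x hx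
    linarith [hC ν, hf ν x a, abs_sub_abs_le_abs_sub (f ν x) (f ν a)]
  set F : ℕ → BoundedContinuousFunction (Set.Icc a b) ℝ := fun ν =>
    BoundedContinuousFunction.mkOfCompact ⟨fun x => f ν x, hcont ν⟩
  have hcpt := BoundedContinuousFunction.arzela_ascoli (Set.Icc (-(C + B)) (C + B)) isCompact_Icc
    (Set.range F) (by
      rintro _ x ⟨ν, rfl⟩
      exact abs_le.1 (hbound ν x x.2)) (fun x => by
      refine Metric.equicontinuousAt_of_continuity_modulus _ (hmod x) _ (.of_forall fun y => ?_)
      rintro ⟨_, ν, rfl⟩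
      exact hf ν x y)
  obtain ⟨g, -, φ, hφ, hg⟩ := hcpt.tendsto_subseq fun ν => subset_closure (Set.mem_range_self ν)
  rw [BoundedContinuousFunction.tendsto_iff_tendstoUniformly] at hg
  refine ⟨φ, fun x => g (Set.projIcc a b hab x), hφ, g.continuous.comp continuous_projIcc, ?_⟩
  refine Metric.tendstoUniformlyOn_iff.2 fun ε hε => ?_
  filter_upwards [Metric.tendstoUniformly_iff.1 hg ε hε] with ν hν x hx
  rw [Set.projIcc_of_mem hab hx]
  exact hν ⟨x, hx⟩

theorem IsWeight.tendsto_integral_signedPow_mul {P C a x : ℝ} {U : ℝ → ℝ} (hU : IsWeight U)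
    (hP : 1 < P) (hax : a ≤ x) {w : ℕ → ℝ → ℝ} {g : ℝ → ℝ} (hw : ∀ ν, Measurable (w ν))
    (hC : ∀ ν t, |w ν t| ≤ C)
    (hlim : ∀ t ∈ Set.Icc a x, Tendsto (fun ν => w ν t) atTop (𝓝 (g t))) :
    Tendsto (fun ν => ∫ t in a..x, signedPow P (w ν t) * U t) atTop
      (𝓝 (∫ t in a..x, signedPow P (g t) * U t)) := by
  have hcont := continuous_signedPow hP
  have hbound : ∀ ν t, |signedPow P (w ν t)| ≤ signedPow P C := fun ν t =>
    abs_signedPow_le hP (hC ν t)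
  refine intervalIntegral.tendsto_integral_filter_of_dominated_convergence
    (fun t => signedPow P C * U t) (.of_forall fun ν => ?_) (.of_forall fun ν =>
    .of_forall fun t _ => ?_) ((hU.int a x).const_mul _) (.of_forall fun t ht => ?_)
  · exact (hU.int_mul (hcont.measurable.comp (hw ν)) (hbound ν) a x).def'.aestronglyMeasurable
  · rw [Real.norm_eq_abs, abs_mul, abs_of_pos (hU.pos t)]
    exact mul_le_mul_of_nonneg_right (hbound ν t) (hU.pos t).le
  · rw [Set.uIoc_of_le hax] at ht
    exact ((hcont.tendsto _).comp (hlim t (Set.Ioc_subset_Icc_self ht))).mul_const _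

/-- The sequence `D` of discrete solutions on finer and finer subdivisions converges: its
multipliers to `c₁, c₂`, its interpolations to `f, g`, its switching points to `t` and the points
where it is normalised to `x₀`. -/
structure IsLimit {P Q a b : ℝ} {U V : ℝ → ℝ} {n : ℕ} {C : ℝ}
    (D : ℕ → DiscreteSolution P Q a b U V n C) (c₁ c₂ : ℝ) (f g : ℝ → ℝ) (t : ℕ → ℝ) (x₀ : ℝ) :
    Prop where
  tendsto_N : Tendsto (fun ν => (D ν).N) atTop atTop
  tendsto_c₁ : Tendsto (fun ν => (D ν).c₁) atTop (𝓝 c₁)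
  tendsto_c₂ : Tendsto (fun ν => (D ν).c₂) atTop (𝓝 c₂)
  continuous_fst : Continuous f
  continuous_snd : Continuous g
  tendsto_fst : TendstoUniformlyOn (fun ν => (D ν).fst) f atTop (Set.Icc a b)
  tendsto_snd : TendstoUniformlyOn (fun ν => (D ν).snd) g atTop (Set.Icc a b)
  tendsto_switch : ∀ k ≤ 2 * n + 1, Tendsto (fun ν => (D ν).pos ((D ν).s k)) atTop (𝓝 (t k))
  tendsto_mid : Tendsto (fun ν => (D ν).pos (D ν).mid) atTop (𝓝 x₀)

section limit

variable {P Q a b : ℝ} {U V : ℝ → ℝ} {n : ℕ} {C : ℝ}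

theorem exists_tendsto_params_subseq (hab : a < b) (D : ℕ → DiscreteSolution P Q a b U V n C) :
    ∃ (φ : ℕ → ℕ) (c₁ c₂ : ℝ) (t : ℕ → ℝ) (x₀ : ℝ), StrictMono φ ∧
      Tendsto (fun ν => (D (φ ν)).c₁) atTop (𝓝 c₁) ∧
      Tendsto (fun ν => (D (φ ν)).c₂) atTop (𝓝 c₂) ∧
      (∀ k ≤ 2 * n + 1, Tendsto (fun ν => (D (φ ν)).pos ((D (φ ν)).s k)) atTop (𝓝 (t k))) ∧
      Tendsto (fun ν => (D (φ ν)).pos (D (φ ν)).mid) atTop (𝓝 x₀) := by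
  set Z : ℕ → (ℝ × ℝ) × (ℕ → ℝ) × ℝ := fun ν => (((D ν).c₁, (D ν).c₂),
    fun k => (D ν).pos (min ((D ν).s k) (2 * (D ν).N)), (D ν).pos (D ν).mid) with hZ
  have hcpt : IsCompact ((Set.Icc 0 C ×ˢ Set.Icc 0 C) ×ˢ
      ((Set.univ.pi fun _ : ℕ => Set.Icc a b) ×ˢ Set.Icc a b)) :=
    (isCompact_Icc.prod isCompact_Icc).prod
      ((isCompact_univ_pi fun _ => isCompact_Icc).prod isCompact_Icc)
  obtain ⟨⟨⟨c₁, c₂⟩, t, x₀⟩, -, φ, hφ, hlim⟩ := hcpt.tendsto_subseq (x := Z) fun ν =>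
    ⟨⟨(D ν).c₁_mem, (D ν).c₂_mem⟩,
      fun k _ => (D ν).pos_mem_Icc hab ((min_le_right _ _).trans (Nat.le_succ _)),
      (D ν).pos_mem_Icc hab ((D ν).mid_le.trans (Nat.le_succ _))⟩
  obtain ⟨hc, hpos⟩ := Prod.tendsto_iff _ _ |>.1 hlim
  obtain ⟨hc₁, hc₂⟩ := Prod.tendsto_iff _ _ |>.1 hc
  obtain ⟨ht, hx₀⟩ := Prod.tendsto_iff _ _ |>.1 hpos
  refine ⟨φ, c₁, c₂, t, x₀, hφ, hc₁, hc₂, fun k hk => ?_, hx₀⟩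
  refine (tendsto_pi_nhds.1 ht k).congr fun ν => ?_
  simp only [hZ, Function.comp_apply, min_eq_left ((D (φ ν)).isWinding.le_last hk)]

theorem exists_isLimit_subseq (hP : 1 < P) (hQ : 1 < Q) (hab : a < b) (hU : IsWeight U)
    (hV : IsWeight V) {D : ℕ → DiscreteSolution P Q a b U V n C}
    (hD : Tendsto (fun ν => (D ν).N) atTop atTop) :
    ∃ (φ : ℕ → ℕ) (c₁ c₂ : ℝ) (f g : ℝ → ℝ) (t : ℕ → ℝ) (x₀ : ℝ),
      IsLimit (D ∘ φ) c₁ c₂ f g t x₀ := by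
  obtain ⟨φ₁, f, hφ₁, hf, hfu⟩ := exists_tendstoUniformlyOn_subseq hab.le (C := 0)
    (continuous_const.mul (intervalIntegral.continuous_primitive hU.int a))
    (fun ν => by rw [(D ν).fst_left, abs_zero]) fun ν => (D ν).abs_fst_sub_fst_le hP hU
  obtain ⟨φ₂, g, hφ₂, hg, hgu⟩ := exists_tendstoUniformlyOn_subseq hab.le (C := C)
    (continuous_const.mul (intervalIntegral.continuous_primitive hV.int a))
    (fun ν => by rw [(D (φ₁ ν)).snd_left]; exact (D (φ₁ ν)).abs_G_le 0 (Nat.zero_le _))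
    fun ν => (D (φ₁ ν)).abs_snd_sub_snd_le hQ hV
  obtain ⟨φ₃, c₁, c₂, t, x₀, hφ₃, hc₁, hc₂, ht, hx₀⟩ :=
    exists_tendsto_params_subseq hab fun ν => D (φ₁ (φ₂ ν))
  have hφ₂₃ : Tendsto (fun ν => φ₂ (φ₃ ν)) atTop atTop :=
    hφ₂.tendsto_atTop.comp hφ₃.tendsto_atTop
  exact ⟨fun ν => φ₁ (φ₂ (φ₃ ν)), c₁, c₂, f, g, t, x₀,
    hD.comp (hφ₁.tendsto_atTop.comp hφ₂₃), hc₁, hc₂, hf, hg,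
    fun u hu => hφ₂₃.eventually (hfu u hu), fun u hu => hφ₃.tendsto_atTop.eventually (hgu u hu),
    ht, hx₀⟩

namespace IsLimit

variable {D : ℕ → DiscreteSolution P Q a b U V n C} {c₁ c₂ : ℝ} {f g : ℝ → ℝ} {t : ℕ → ℝ}
  {x₀ x : ℝ} {i j : ℕ → ℕ}

theorem tendsto_mesh (h : IsLimit D c₁ c₂ f g t x₀) :
    Tendsto (fun ν => (b - a) / ((D ν).N : ℝ)) atTop (𝓝 0) :=
  (tendsto_natCast_atTop_atTop.comp h.tendsto_N).const_div_atTop _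

theorem tendsto_pos_of_near (h : IsLimit D c₁ c₂ f g t x₀) (hab : a < b)
    (hij : ∀ ν, i ν ≤ j ν + 1 ∧ j ν ≤ i ν + 1)
    (hx : Tendsto (fun ν => (D ν).pos (j ν)) atTop (𝓝 x)) :
    Tendsto (fun ν => (D ν).pos (i ν)) atTop (𝓝 x) := by
  have hsub : Tendsto (fun ν => (D ν).pos (i ν) - (D ν).pos (j ν)) atTop (𝓝 0) := by
    refine squeeze_zero_norm (fun ν => ?_) h.tendsto_mesh
    have h₁ : ((i ν / 2 : ℕ) : ℝ) ≤ (j ν / 2 : ℕ) + 1 := by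
      exact_mod_cast (show i ν / 2 ≤ j ν / 2 + 1 by have := hij ν; omega)
    have h₂ : ((j ν / 2 : ℕ) : ℝ) ≤ (i ν / 2 : ℕ) + 1 := by
      exact_mod_cast (show j ν / 2 ≤ i ν / 2 + 1 by have := hij ν; omega)
    rw [DiscreteSolution.pos, DiscreteSolution.pos, node_sub_node, Real.norm_eq_abs, abs_mul,
      abs_of_pos (sub_pos.2 hab), abs_div, Nat.abs_cast, div_eq_mul_one_div (b - a)]
    gcongr
    exact abs_le.2 ⟨by linarith, by linarith⟩
  simpa only [zero_add, sub_add_cancel] using hsub.add hx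

theorem tendsto_pos_cell (h : IsLimit D c₁ c₂ f g t x₀) (hab : a < b) (hx : x ∈ Set.Icc a b) :
    Tendsto (fun ν => (D ν).pos (2 * cell a b (D ν).N x)) atTop (𝓝 x) := by
  have hlow : Tendsto (fun ν => x - (b - a) / ((D ν).N : ℝ)) atTop (𝓝 x) := by
    simpa only [sub_zero] using tendsto_const_nhds.sub h.tendsto_mesh
  refine tendsto_of_tendsto_of_tendsto_of_le_of_le hlow tendsto_const_nhds (fun ν => ?_) fun ν => ?_
  · have hmem := (mem_Icc_node_cell hab (D ν).N_pos hx).2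
    have hstep := node_sub_node (a := a) (b := b) (N := (D ν).N) (cell a b (D ν).N x)
      (cell a b (D ν).N x + 1)
    rw [Nat.cast_add_one, add_sub_cancel_left, mul_one_div] at hstep
    simp only [DiscreteSolution.pos, Nat.mul_div_cancel_left _ two_pos]
    linarith
  · simpa only [DiscreteSolution.pos, Nat.mul_div_cancel_left _ two_pos] using
      (mem_Icc_node_cell hab (D ν).N_pos hx).1

theorem tendsto_F (h : IsLimit D c₁ c₂ f g t x₀) (hab : a < b) (hU : IsWeight U)
    (hj : ∀ ν, j ν ≤ 2 * (D ν).N) (hx : Tendsto (fun ν => (D ν).pos (j ν)) atTop (𝓝 x)) :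
    Tendsto (fun ν => (D ν).F (j ν)) atTop (𝓝 (f x)) := by
  have hpos : Tendsto (fun ν => (D ν).pos (j ν + 1)) atTop (𝓝[Set.Icc a b] x) :=
    tendsto_nhdsWithin_iff.2 ⟨h.tendsto_pos_of_near hab (fun ν => by omega) hx,
      .of_forall fun ν => (D ν).pos_mem_Icc hab (Nat.succ_le_succ (hj ν))⟩
  exact (h.tendsto_fst.tendsto_comp h.continuous_fst.continuousWithinAt hpos).congr
    fun ν => (D ν).fst_pos hab hU (hj ν)

theorem tendsto_G (h : IsLimit D c₁ c₂ f g t x₀) (hab : a < b) (hV : IsWeight V)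
    (hj : ∀ ν, j ν ≤ 2 * (D ν).N) (hx : Tendsto (fun ν => (D ν).pos (j ν)) atTop (𝓝 x)) :
    Tendsto (fun ν => (D ν).G (j ν)) atTop (𝓝 (g x)) := by
  have hpos : Tendsto (fun ν => (D ν).pos (j ν)) atTop (𝓝[Set.Icc a b] x) :=
    tendsto_nhdsWithin_iff.2
      ⟨hx, .of_forall fun ν => (D ν).pos_mem_Icc hab (Nat.le_succ_of_le (hj ν))⟩
  exact (h.tendsto_snd.tendsto_comp h.continuous_snd.continuousWithinAt hpos).congr
    fun ν => (D ν).snd_pos hab hV (hj ν)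

theorem fst_eq (h : IsLimit D c₁ c₂ f g t x₀) (hP : 1 < P) (hab : a < b) (hU : IsWeight U)
    (hV : IsWeight V) (hx : x ∈ Set.Icc a b) :
    f x = c₁ * ∫ s in a..x, signedPow P (g s) * U s := by
  have hlim := hU.tendsto_integral_signedPow_mul hP hx.1 (fun ν => (D ν).measurable_G_cell)
    (fun ν => (D ν).abs_G_cell_le) fun s hs => h.tendsto_G hab hV
      (fun ν => (Nat.le_succ _).trans ((D ν).two_mul_cell_lt s))
      (h.tendsto_pos_cell hab ⟨hs.1, hs.2.trans hx.2⟩)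
  exact tendsto_nhds_unique (h.tendsto_fst.tendsto_at hx) (h.tendsto_c₁.mul hlim)

theorem snd_eq (h : IsLimit D c₁ c₂ f g t x₀) (hQ : 1 < Q) (hab : a < b) (hU : IsWeight U)
    (hV : IsWeight V) (hx : x ∈ Set.Icc a b) :
    g x = g a - c₂ * ∫ s in a..x, signedPow Q (f s) * V s := by
  have hlim := hV.tendsto_integral_signedPow_mul hQ hx.1 (fun ν => (D ν).measurable_F_cell)
    (fun ν => (D ν).abs_F_cell_le) fun s hs => h.tendsto_F hab hU (fun ν => (D ν).two_mul_cell_lt s)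
      (h.tendsto_pos_of_near hab (fun ν => by omega)
        (h.tendsto_pos_cell hab ⟨hs.1, hs.2.trans hx.2⟩))
  have hleft : Tendsto (fun ν => (D ν).G 0) atTop (𝓝 (g a)) := by
    simpa only [DiscreteSolution.snd_left] using
      h.tendsto_snd.tendsto_at (Set.left_mem_Icc.2 hab.le)
  exact tendsto_nhds_unique (h.tendsto_snd.tendsto_at hx) (hleft.sub (h.tendsto_c₂.mul hlim))

theorem inQuadrant (h : IsLimit D c₁ c₂ f g t x₀) (hab : a < b) (hU : IsWeight U)
    (hV : IsWeight V) {k : ℕ} (hk : k ≤ 2 * n) (hxI : x ∈ Set.Icc a b)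
    (hx : x ∈ Set.Icc (t k) (t (k + 1))) : InQuadrant k (f x) (g x) := by
  -- The index of the cell of `x`, moved into the `k`-th block.
  set j : ℕ → ℕ := fun ν => max ((D ν).s k) (min ((D ν).s (k + 1) - 1) (2 * cell a b (D ν).N x))
    with hj
  have hlt : ∀ ν, (D ν).s k < (D ν).s (k + 1) := fun ν => (D ν).isWinding.lt k hk
  have hjlt : ∀ ν, j ν < (D ν).s (k + 1) := fun ν => by
    have := hlt ν
    simp only [hj]
    omega
  have hjN : ∀ ν, j ν ≤ 2 * (D ν).N := fun ν =>
    (hjlt ν).le.trans ((D ν).isWinding.le_last (Nat.succ_le_succ hk))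
  have hpos : Tendsto (fun ν => (D ν).pos (j ν)) atTop (𝓝 x) := by
    have hpred : Tendsto (fun ν => (D ν).pos ((D ν).s (k + 1) - 1)) atTop (𝓝 (t (k + 1))) :=
      h.tendsto_pos_of_near hab (fun ν => by have := hlt ν; omega)
        (h.tendsto_switch (k + 1) (Nat.succ_le_succ hk))
    have hlim := (h.tendsto_switch k (Nat.le_succ_of_le hk)).max
      (hpred.min (h.tendsto_pos_cell hab hxI))
    rw [min_eq_right hx.2, max_eq_right hx.1] at hlim
    exact hlim.congr fun ν => by
      rw [hj, ((D ν).monotone_pos hab).map_max, ((D ν).monotone_pos hab).map_min]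
  exact (isClosed_inQuadrant k).mem_of_tendsto
    ((h.tendsto_F hab hU hjN hpos).prodMk_nhds (h.tendsto_G hab hV hjN hpos))
    (.of_forall fun ν => (D ν).isWinding.mem k hk _ (le_max_left _ _) (hjlt ν))

end IsLimit

end limit

/-! ### Winding solutions -/

/-- `f` and `g` are continuous and solve the integrated form on `I` of the system
`f' = c₁ φ_P(g) U`, `g' = -c₂ φ_Q(f) V`, where `φ_P` is the signed power. -/
structure IsSolutionOn (P Q : ℝ) (U V : ℝ → ℝ) (c₁ c₂ : ℝ) (f g : ℝ → ℝ) (I : Set ℝ) : Prop where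
  continuous_fst : Continuous f
  continuous_snd : Continuous g
  fst_sub : ∀ x ∈ I, ∀ y ∈ I, f y - f x = c₁ * ∫ s in x..y, signedPow P (g s) * U s
  snd_sub : ∀ x ∈ I, ∀ y ∈ I, g x - g y = c₂ * ∫ s in x..y, signedPow Q (f s) * V s

/-- A solution on `[x, y]` that stays in quadrant `k`, entering and leaving it through its two
half-axes. -/
structure IsArc (P Q : ℝ) (U V : ℝ → ℝ) (c₁ c₂ : ℝ) (k : ℕ) (f g : ℝ → ℝ) (x y : ℝ) : Prop where
  isSolutionOn : IsSolutionOn P Q U V c₁ c₂ f g (Set.Icc x y)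
  le : x ≤ y
  mem : ∀ z ∈ Set.Icc x y, InQuadrant k (f z) (g z)
  axis_of_even : Even k → f x = 0 ∧ g y = 0
  axis_of_odd : Odd k → g x = 0 ∧ f y = 0

theorem IsWeight.intervalIntegrable_signedPow_mul {P : ℝ} {U g : ℝ → ℝ} (hU : IsWeight U)
    (hP : 1 < P) (hg : Continuous g) (x y : ℝ) :
    IntervalIntegrable (fun s => signedPow P (g s) * U s) volume x y :=
  (hU.int x y).continuousOn_mul ((continuous_signedPow hP).comp hg).continuousOn

theorem IsWeight.eq_zero_of_integral_signedPow_mul_eq_zero {P x y : ℝ} {U g : ℝ → ℝ}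
    (hU : IsWeight U) (hP : 1 < P) (hg : Continuous g) (hxy : x < y)
    (hnonneg : ∀ z ∈ Set.Icc x y, 0 ≤ g z)
    (h : ∫ s in x..y, signedPow P (g s) * U s = 0) : ∀ z ∈ Set.Icc x y, g z = 0 := by
  have hint := (intervalIntegrable_iff_integrableOn_Icc_of_le hxy.le).1
    (hU.intervalIntegrable_signedPow_mul hP hg x y)
  rw [intervalIntegral.integral_of_le hxy.le, ← integral_Icc_eq_integral_Ioc,
    integral_eq_zero_iff_of_nonneg_ae _ hint] at h
  · have hae : g =ᵐ[volume.restrict (Set.Icc x y)] 0 := h.mono fun z hz => by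
      by_contra hgz
      exact mul_ne_zero (signedPow_ne_zero hgz) (hU.pos z).ne' hz
    exact Measure.eqOn_Icc_of_ae_eq volume hxy.ne hae hg.continuousOn continuousOn_const
  · exact (ae_restrict_iff' measurableSet_Icc).2 <| .of_forall fun z hz =>
      mul_nonneg (signedPow_nonneg (hnonneg z hz)) (hU.pos z).le

section arc

variable {P Q c₁ c₂ x y z : ℝ} {U V f g : ℝ → ℝ} {k : ℕ}

namespace IsSolutionOn

variable {I J : Set ℝ}

theorem mono (h : IsSolutionOn P Q U V c₁ c₂ f g J) (hIJ : I ⊆ J) :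
    IsSolutionOn P Q U V c₁ c₂ f g I :=
  ⟨h.continuous_fst, h.continuous_snd, fun x hx y hy => h.fst_sub x (hIJ hx) y (hIJ hy),
    fun x hx y hy => h.snd_sub x (hIJ hx) y (hIJ hy)⟩

theorem rotate (h : IsSolutionOn P Q U V c₁ c₂ f g I) :
    IsSolutionOn Q P V U c₂ c₁ (-g) f I where
  continuous_fst := h.continuous_snd.neg
  continuous_snd := h.continuous_fst
  fst_sub x hx y hy := by rw [← h.snd_sub x hx y hy, Pi.neg_apply, Pi.neg_apply, neg_sub_neg]
  snd_sub x hx y hy := by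
    simp only [Pi.neg_apply, signedPow_neg, neg_mul, intervalIntegral.integral_neg, mul_neg,
      ← h.fst_sub x hx y hy, neg_sub]

theorem snd_eq_zero (h : IsSolutionOn P Q U V c₁ c₂ f g (Set.Icc x y)) (hP : 1 < P)
    (hU : IsWeight U) (hc₁ : c₁ ≠ 0) (hxy : x < y) (hg : ∀ z ∈ Set.Icc x y, 0 ≤ g z)
    (hf : f x = f y) : ∀ z ∈ Set.Icc x y, g z = 0 := by
  refine hU.eq_zero_of_integral_signedPow_mul_eq_zero hP h.continuous_snd hxy hg ?_
  have hsub := h.fst_sub x (Set.left_mem_Icc.2 hxy.le) y (Set.right_mem_Icc.2 hxy.le)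
  rw [hf, sub_self] at hsub
  exact (mul_eq_zero.1 hsub.symm).resolve_left hc₁

end IsSolutionOn

namespace IsArc

theorem rotate (h : IsArc P Q U V c₁ c₂ (k + 1) f g x y) :
    IsArc Q P V U c₂ c₁ k (-g) f x y where
  isSolutionOn := h.isSolutionOn.rotate
  le := h.le
  mem := h.mem
  axis_of_even hk := by simpa only [Pi.neg_apply, neg_eq_zero] using h.axis_of_odd hk.add_one
  axis_of_odd hk := by simpa only [Pi.neg_apply, neg_eq_zero] using h.axis_of_even hk.add_one

theorem snd_eq_zero (h : IsArc P Q U V c₁ c₂ 0 f g x y) (hP : 1 < P) (hU : IsWeight U)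
    (hc₁ : c₁ ≠ 0) (hxz : x < z) (hzy : z ≤ y) (hf : f z = 0) : ∀ w ∈ Set.Icc x z, g w = 0 :=
  (h.isSolutionOn.mono (Set.Icc_subset_Icc_right hzy)).snd_eq_zero hP hU hc₁ hxz
    (fun w hw => (h.mem w ⟨hw.1, hw.2.trans hzy⟩).2) ((h.axis_of_even Even.zero).1.trans hf.symm)

theorem fst_eq_zero (h : IsArc P Q U V c₁ c₂ 0 f g x y) (hQ : 1 < Q) (hV : IsWeight V)
    (hc₂ : c₂ ≠ 0) (hxz : x ≤ z) (hzy : z < y) (hg : g z = 0) : ∀ w ∈ Set.Icc z y, f w = 0 :=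
  (h.isSolutionOn.mono (Set.Icc_subset_Icc_left hxz)).rotate.snd_eq_zero hQ hV hc₂ hzy
    (fun w hw => (h.mem w ⟨hxz.trans hw.1, hw.2⟩).1)
    (congrArg Neg.neg (hg.trans (h.axis_of_even Even.zero).2.symm))

theorem eq_zero_of_eq_zero (h : IsArc P Q U V c₁ c₂ k f g x y) (hP : 1 < P) (hQ : 1 < Q)
    (hU : IsWeight U) (hV : IsWeight V) (hc₁ : c₁ ≠ 0) (hc₂ : c₂ ≠ 0) (hz : z ∈ Set.Icc x y)
    (hfz : f z = 0) (hgz : g z = 0) : ∀ w ∈ Set.Icc x y, f w = 0 ∧ g w = 0 := by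
  induction k generalizing P Q U V c₁ c₂ f g with
  | zero =>
    obtain ⟨hfx, hgy⟩ := h.axis_of_even Even.zero
    have hgx : g x = 0 := hz.1.eq_or_lt.elim (fun he => he ▸ hgz) fun hxz =>
      h.snd_eq_zero hP hU hc₁ hxz hz.2 hfz x (Set.left_mem_Icc.2 hz.1)
    have hfy : f y = 0 := hz.2.eq_or_lt.elim (fun he => he ▸ hfz) fun hzy =>
      h.fst_eq_zero hQ hV hc₂ hz.1 hzy hgz y (Set.right_mem_Icc.2 hz.2)
    intro w hw
    rcases h.le.eq_or_lt with rfl | hxy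
    · rw [le_antisymm hw.2 hw.1]
      exact ⟨hfx, hgx⟩
    · exact ⟨h.fst_eq_zero hQ hV hc₂ le_rfl hxy hgx w hw,
        h.snd_eq_zero hP hU hc₁ hxy le_rfl hfy w hw⟩
  | succ k ih =>
    exact fun w hw => (ih h.rotate hQ hP hV hU hc₂ hc₁ (neg_eq_zero.2 hgz) hfz w hw).symm.imp_right
      neg_eq_zero.1

theorem left_lt_right (h : IsArc P Q U V c₁ c₂ k f g x y) (hx : ¬(f x = 0 ∧ g x = 0)) : x < y := by
  refine h.le.lt_of_ne fun hxy => hx ?_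
  rcases k.even_or_odd with hk | hk
  · exact (h.axis_of_even hk).imp_right (hxy ▸ ·)
  · exact (h.axis_of_odd hk).symm.imp_left (hxy ▸ ·)

theorem eq_left_or_eq_right (h : IsArc P Q U V c₁ c₂ k f g x y) (hP : 1 < P) (hQ : 1 < Q)
    (hU : IsWeight U) (hV : IsWeight V) (hc₁ : c₁ ≠ 0) (hc₂ : c₂ ≠ 0)
    (hne : ∀ w ∈ Set.Icc x y, ¬(f w = 0 ∧ g w = 0)) (hz : z ∈ Set.Icc x y)
    (hfg : f z = 0 ∨ g z = 0) : z = x ∨ z = y := by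
  induction k generalizing P Q U V c₁ c₂ f g with
  | zero =>
    obtain ⟨hfx, hgy⟩ := h.axis_of_even Even.zero
    refine hfg.imp (fun hfz => ?_) fun hgz => ?_ <;> by_contra hzne
    · have hxz := hz.1.lt_of_ne' hzne
      exact hne x (Set.left_mem_Icc.2 h.le)
        ⟨hfx, h.snd_eq_zero hP hU hc₁ hxz hz.2 hfz x (Set.left_mem_Icc.2 hz.1)⟩
    · have hzy := hz.2.lt_of_ne hzne
      exact hne y (Set.right_mem_Icc.2 h.le)
        ⟨h.fst_eq_zero hQ hV hc₂ hz.1 hzy hgz y (Set.right_mem_Icc.2 hz.2), hgy⟩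
  | succ k ih =>
    exact ih h.rotate hQ hP hV hU hc₂ hc₁
      (fun w hw hw0 => hne w hw (hw0.symm.imp_right neg_eq_zero.1))
      (hfg.symm.imp_left neg_eq_zero.2)

end IsArc

end arc

/-- A solution on `[a, b]` that starts on the axis `f = 0`, ends on the axis `g = 0`, does not
vanish identically and runs through the quadrants `0, 1, …, 2n` in order, switching from quadrant
`k` to quadrant `k + 1` at `t (k + 1)`. -/
structure IsWindingSolution (P Q a b : ℝ) (U V : ℝ → ℝ) (n : ℕ) (c₁ c₂ : ℝ) (f g : ℝ → ℝ)
    (t : ℕ → ℝ) : Prop where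
  isSolutionOn : IsSolutionOn P Q U V c₁ c₂ f g (Set.Icc a b)
  fst_left : f a = 0
  snd_right : g b = 0
  start : t 0 = a
  last : t (2 * n + 1) = b
  le_succ : ∀ k ≤ 2 * n, t k ≤ t (k + 1)
  mem : ∀ k ≤ 2 * n, ∀ x ∈ Set.Icc (t k) (t (k + 1)), InQuadrant k (f x) (g x)
  exists_ne_zero : ∃ x ∈ Set.Icc a b, f x ≠ 0 ∧ g x ≠ 0

section existence

variable {P Q a b : ℝ} {U V : ℝ → ℝ} {n : ℕ} {C : ℝ} {D : ℕ → DiscreteSolution P Q a b U V n C}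
  {c₁ c₂ : ℝ} {f g : ℝ → ℝ} {t : ℕ → ℝ} {x₀ : ℝ}

theorem mem_Icc_of_tendsto_pos (hab : a < b) {j : ℕ → ℕ} {x : ℝ} (hj : ∀ ν, j ν ≤ 2 * (D ν).N)
    (hx : Tendsto (fun ν => (D ν).pos (j ν)) atTop (𝓝 x)) : x ∈ Set.Icc a b :=
  isClosed_Icc.mem_of_tendsto hx <| .of_forall fun ν =>
    (D ν).pos_mem_Icc hab (Nat.le_succ_of_le (hj ν))

theorem IsLimit.isSolutionOn (h : IsLimit D c₁ c₂ f g t x₀) (hP : 1 < P) (hQ : 1 < Q) (hab : a < b)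
    (hU : IsWeight U) (hV : IsWeight V) : IsSolutionOn P Q U V c₁ c₂ f g (Set.Icc a b) where
  continuous_fst := h.continuous_fst
  continuous_snd := h.continuous_snd
  fst_sub x hx y hy := by
    have hint := hU.intervalIntegrable_signedPow_mul hP h.continuous_snd
    rw [h.fst_eq hP hab hU hV hx, h.fst_eq hP hab hU hV hy, ← mul_sub,
      intervalIntegral.integral_interval_sub_left (hint _ _) (hint _ _)]
  snd_sub x hx y hy := by
    have hint := hV.intervalIntegrable_signedPow_mul hQ h.continuous_fst
    rw [h.snd_eq hQ hab hU hV hx, h.snd_eq hQ hab hU hV hy, sub_sub_sub_cancel_left, ← mul_sub,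
      intervalIntegral.integral_interval_sub_left (hint _ _) (hint _ _)]

theorem IsLimit.exists_ne_zero (h : IsLimit D c₁ c₂ f g t x₀) (hab : a < b) (hU : IsWeight U)
    (hV : IsWeight V) : ∃ x ∈ Set.Icc a b, f x ≠ 0 ∧ g x ≠ 0 := by
  have hmid : ∀ ν, (D ν).mid ≤ 2 * (D ν).N := fun ν => (D ν).mid_le
  have hfst : |f x₀| = 1 := tendsto_nhds_unique (h.tendsto_F hab hU hmid h.tendsto_mid).abs
    (tendsto_const_nhds.congr fun ν => (D ν).abs_F_mid.symm)
  have hsnd : |g x₀| = 1 := tendsto_nhds_unique (h.tendsto_G hab hV hmid h.tendsto_mid).abs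
    (tendsto_const_nhds.congr fun ν => (D ν).abs_G_mid.symm)
  exact ⟨x₀, mem_Icc_of_tendsto_pos hab hmid h.tendsto_mid,
    abs_ne_zero.1 (hfst.trans_ne one_ne_zero), abs_ne_zero.1 (hsnd.trans_ne one_ne_zero)⟩

theorem IsLimit.isWindingSolution (h : IsLimit D c₁ c₂ f g t x₀) (hP : 1 < P) (hQ : 1 < Q)
    (hab : a < b) (hU : IsWeight U) (hV : IsWeight V) :
    IsWindingSolution P Q a b U V n c₁ c₂ f g t where
  isSolutionOn := h.isSolutionOn hP hQ hab hU hV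
  fst_left := by
    rw [h.fst_eq hP hab hU hV (Set.left_mem_Icc.2 hab.le), intervalIntegral.integral_same, mul_zero]
  snd_right := by
    refine tendsto_nhds_unique (h.tendsto_G hab hV (fun ν => le_rfl) ?_)
      (tendsto_const_nhds.congr fun ν => (D ν).isWinding.snd_last.symm)
    exact tendsto_const_nhds.congr fun ν => (D ν).pos_last.symm
  start := by
    refine tendsto_nhds_unique (h.tendsto_switch 0 (Nat.zero_le _))
      (tendsto_const_nhds.congr fun ν => ?_)
    rw [(D ν).isWinding.start, (D ν).pos_zero]
  last := by
    refine tendsto_nhds_unique (h.tendsto_switch _ le_rfl) (tendsto_const_nhds.congr fun ν => ?_)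
    rw [(D ν).isWinding.last, (D ν).pos_last]
  le_succ k hk := le_of_tendsto_of_tendsto' (h.tendsto_switch k (Nat.le_succ_of_le hk))
    (h.tendsto_switch (k + 1) (Nat.succ_le_succ hk)) fun ν =>
      (D ν).monotone_pos hab ((D ν).isWinding.lt k hk).le
  mem k hk x hx := by
    have ht : ∀ j ≤ 2 * n + 1, t j ∈ Set.Icc a b := fun j hj => mem_Icc_of_tendsto_pos hab
      (fun ν => (D ν).isWinding.le_last hj) (h.tendsto_switch j hj)
    exact h.inQuadrant hab hU hV hk ⟨(ht k (Nat.le_succ_of_le hk)).1.trans hx.1,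
      hx.2.trans (ht (k + 1) (Nat.succ_le_succ hk)).2⟩ hx
  exists_ne_zero := h.exists_ne_zero hab hU hV

end existence

theorem exists_isWindingSolution {P Q a b : ℝ} {U V : ℝ → ℝ} (hP : 1 < P) (hQ : 1 < Q)
    (hab : a < b) (hU : IsWeight U) (hV : IsWeight V) (n : ℕ) :
    ∃ (c₁ c₂ : ℝ) (f g : ℝ → ℝ) (t : ℕ → ℝ), IsWindingSolution P Q a b U V n c₁ c₂ f g t := by
  obtain ⟨N₀, C, hex⟩ := exists_discreteSolution hP hQ hab hU hV n
  choose D hD using fun ν => hex (N₀ + ν) (Nat.le_add_right _ _)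
  have hN : Tendsto (fun ν => (D ν).N) atTop atTop :=
    tendsto_atTop_mono (fun ν => (Nat.le_add_left ν N₀).trans_eq (hD ν).symm) tendsto_id
  obtain ⟨φ, c₁, c₂, f, g, t, x₀, h⟩ := exists_isLimit_subseq hP hQ hab hU hV hN
  exact ⟨c₁, c₂, f, g, t, h.isWindingSolution hP hQ hab hU hV⟩

namespace IsWindingSolution

variable {P Q a b : ℝ} {U V : ℝ → ℝ} {n : ℕ} {c₁ c₂ z : ℝ} {f g : ℝ → ℝ} {t : ℕ → ℝ} {k : ℕ}

theorem fst_coeff_ne_zero (h : IsWindingSolution P Q a b U V n c₁ c₂ f g t) : c₁ ≠ 0 := by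
  rintro rfl
  obtain ⟨x, hx, hfx, -⟩ := h.exists_ne_zero
  have hsub := h.isSolutionOn.fst_sub a (Set.left_mem_Icc.2 (hx.1.trans hx.2)) x hx
  rw [h.fst_left, zero_mul, sub_zero] at hsub
  exact hfx hsub

theorem snd_coeff_ne_zero (h : IsWindingSolution P Q a b U V n c₁ c₂ f g t) : c₂ ≠ 0 := by
  rintro rfl
  obtain ⟨x, hx, -, hgx⟩ := h.exists_ne_zero
  have hsub := h.isSolutionOn.snd_sub x hx b (Set.right_mem_Icc.2 (hx.1.trans hx.2))
  rw [h.snd_right, zero_mul, sub_zero] at hsub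
  exact hgx hsub

theorem monotoneOn (h : IsWindingSolution P Q a b U V n c₁ c₂ f g t) :
    MonotoneOn t (Set.Iic (2 * n + 1)) :=
  monotoneOn_of_le_succ Set.ordConnected_Iic fun k _ _ hk => h.le_succ k (Nat.lt_succ_iff.1 hk)

theorem switch_mem (h : IsWindingSolution P Q a b U V n c₁ c₂ f g t) (hk : k ≤ 2 * n + 1) :
    t k ∈ Set.Icc a b :=
  ⟨h.start ▸ h.monotoneOn (Nat.zero_le _) hk k.zero_le,
    h.last ▸ h.monotoneOn hk Set.self_mem_Iic hk⟩

theorem exists_mem_arc (h : IsWindingSolution P Q a b U V n c₁ c₂ f g t) (hz : z ∈ Set.Icc a b) :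
    ∃ k ≤ 2 * n, z ∈ Set.Icc (t k) (t (k + 1)) := by
  by_contra! hnot
  have hle : ∀ k ≤ 2 * n + 1, t k ≤ z := fun k => by
    induction k with
    | zero => exact fun _ => h.start.trans_le hz.1
    | succ k ih =>
      intro hk
      by_contra! hlt
      exact hnot k (Nat.le_of_succ_le_succ hk) ⟨ih (Nat.le_of_succ_le hk), hlt.le⟩
  exact hnot (2 * n) le_rfl ⟨hle _ (Nat.le_succ _), hz.2.trans_eq h.last.symm⟩

theorem axis (h : IsWindingSolution P Q a b U V n c₁ c₂ f g t) (hk : k ≤ 2 * n + 1) :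
    (Even k → f (t k) = 0) ∧ (Odd k → g (t k) = 0) := by
  rcases k with _ | k
  · exact ⟨fun _ => h.start.symm ▸ h.fst_left, fun h0 => absurd h0 Nat.not_odd_zero⟩
  rcases hk.eq_or_lt with he | hlt
  · rw [he, h.last]
    exact ⟨fun h0 => absurd h0 (by simp), fun _ => h.snd_right⟩
  have hk' : k ≤ 2 * n := Nat.le_of_succ_le_succ hk
  have hk₁ : k + 1 ≤ 2 * n := Nat.le_of_lt_succ hlt
  have haxis := (h.mem k hk' _ (Set.right_mem_Icc.2 (h.le_succ k hk'))).axis_of_succ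
    (h.mem (k + 1) hk₁ _ (Set.left_mem_Icc.2 (h.le_succ (k + 1) hk₁)))
  rw [Nat.even_add_one, Nat.not_even_iff_odd, Nat.odd_add_one, Nat.not_odd_iff_even]
  exact haxis.symm

theorem isArc (h : IsWindingSolution P Q a b U V n c₁ c₂ f g t) (hk : k ≤ 2 * n) :
    IsArc P Q U V c₁ c₂ k f g (t k) (t (k + 1)) where
  isSolutionOn := h.isSolutionOn.mono <| Set.Icc_subset_Icc (h.switch_mem (Nat.le_succ_of_le hk)).1
    (h.switch_mem (Nat.succ_le_succ hk)).2
  le := h.le_succ k hk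
  mem := h.mem k hk
  axis_of_even he := ⟨(h.axis (Nat.le_succ_of_le hk)).1 he,
    (h.axis (Nat.succ_le_succ hk)).2 he.add_one⟩
  axis_of_odd ho := ⟨(h.axis (Nat.le_succ_of_le hk)).2 ho,
    (h.axis (Nat.succ_le_succ hk)).1 ho.add_one⟩

/-- Uniqueness for the initial value problem may fail, but a common zero of `f` and `g` spreads over
its arc, and from there to the neighbouring arcs. -/
theorem ne_zero (h : IsWindingSolution P Q a b U V n c₁ c₂ f g t) (hP : 1 < P) (hQ : 1 < Q)
    (hU : IsWeight U) (hV : IsWeight V) (hz : z ∈ Set.Icc a b) : ¬(f z = 0 ∧ g z = 0) := by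
  rintro ⟨hfz, hgz⟩
  have harc : ∀ k ≤ 2 * n, ∀ w ∈ Set.Icc (t k) (t (k + 1)), f w = 0 ∧ g w = 0 →
      ∀ w ∈ Set.Icc (t k) (t (k + 1)), f w = 0 ∧ g w = 0 := fun k hk w hw h0 =>
    (h.isArc hk).eq_zero_of_eq_zero hP hQ hU hV h.fst_coeff_ne_zero h.snd_coeff_ne_zero hw h0.1 h0.2
  have hl : ∀ k ≤ 2 * n, t k ∈ Set.Icc (t k) (t (k + 1)) := fun k hk =>
    Set.left_mem_Icc.2 (h.le_succ k hk)
  have hr : ∀ k ≤ 2 * n, t (k + 1) ∈ Set.Icc (t k) (t (k + 1)) := fun k hk =>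
    Set.right_mem_Icc.2 (h.le_succ k hk)
  have hiff : ∀ k ≤ 2 * n, (f (t k) = 0 ∧ g (t k) = 0) ↔ (f (t 0) = 0 ∧ g (t 0) = 0) := fun k => by
    induction k with
    | zero => exact fun _ => Iff.rfl
    | succ k ih =>
      intro hk
      have hk' := Nat.le_of_succ_le hk
      rw [← ih hk']
      exact ⟨fun h0 => harc k hk' _ (hr k hk') h0 _ (hl k hk'),
        fun h0 => harc k hk' _ (hl k hk') h0 _ (hr k hk')⟩
  obtain ⟨x, hx, hfx, -⟩ := h.exists_ne_zero
  obtain ⟨i, hi, hzi⟩ := h.exists_mem_arc hz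
  obtain ⟨j, hj, hxj⟩ := h.exists_mem_arc hx
  have hzero := (hiff i hi).1 (harc i hi z hzi ⟨hfz, hgz⟩ _ (hl i hi))
  exact hfx (harc j hj _ (hl j hj) ((hiff j hj).2 hzero) x hxj).1

theorem strictMonoOn (h : IsWindingSolution P Q a b U V n c₁ c₂ f g t) (hP : 1 < P) (hQ : 1 < Q)
    (hU : IsWeight U) (hV : IsWeight V) : StrictMonoOn t (Set.Iic (2 * n + 1)) :=
  strictMonoOn_of_lt_succ Set.ordConnected_Iic fun _ _ hk hk' =>
    (h.isArc (Nat.lt_succ_iff.1 hk')).left_lt_right (h.ne_zero hP hQ hU hV (h.switch_mem hk))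

theorem fst_eq_zero_iff (h : IsWindingSolution P Q a b U V n c₁ c₂ f g t) (hP : 1 < P) (hQ : 1 < Q)
    (hU : IsWeight U) (hV : IsWeight V) (hz : z ∈ Set.Icc a b) :
    f z = 0 ↔ ∃ i ≤ n, t (2 * i) = z := by
  constructor
  · intro hfz
    obtain ⟨k, hk, hzk⟩ := h.exists_mem_arc hz
    have hends := (h.isArc hk).eq_left_or_eq_right hP hQ hU hV
      h.fst_coeff_ne_zero h.snd_coeff_ne_zero
      (fun w hw => h.ne_zero hP hQ hU hV ⟨(h.switch_mem (Nat.le_succ_of_le hk)).1.trans hw.1,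
        hw.2.trans (h.switch_mem (Nat.succ_le_succ hk)).2⟩) hzk (Or.inl hfz)
    obtain ⟨m, hm, rfl⟩ : ∃ m ≤ 2 * n + 1, z = t m := hends.elim
      (fun he => ⟨k, Nat.le_succ_of_le hk, he⟩) fun he => ⟨k + 1, Nat.succ_le_succ hk, he⟩
    obtain ⟨i, rfl⟩ : Even m := Nat.not_odd_iff_even.1 fun ho =>
      h.ne_zero hP hQ hU hV hz ⟨hfz, (h.axis hm).2 ho⟩
    exact ⟨i, by omega, by rw [two_mul]⟩
  · rintro ⟨i, hi, rfl⟩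
    exact (h.axis (by omega)).1 (even_two_mul i)

theorem zeroCount_fst (h : IsWindingSolution P Q a b U V n c₁ c₂ f g t) (hP : 1 < P) (hQ : 1 < Q)
    (hU : IsWeight U) (hV : IsWeight V) : zeroCount a b f = n := by
  have hmono := h.strictMonoOn hP hQ hU hV
  have hlt : ∀ {i j : ℕ}, i < j → j ≤ 2 * n + 1 → t i < t j := fun hij hj =>
    hmono (hij.le.trans hj) hj hij
  have hset : {x ∈ Set.Ioo a b | f x = 0} = (fun i => t (2 * i)) '' (Finset.Icc 1 n : Set ℕ) := by
    ext z
    simp only [Set.mem_image, Finset.coe_Icc, Set.mem_Icc]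
    constructor
    · rintro ⟨hz, hfz⟩
      obtain ⟨i, hi, rfl⟩ := (h.fst_eq_zero_iff hP hQ hU hV (Set.Ioo_subset_Icc_self hz)).1 hfz
      refine ⟨i, ⟨Nat.one_le_iff_ne_zero.2 ?_, hi⟩, rfl⟩
      rintro rfl
      exact hz.1.ne' h.start
    · rintro ⟨i, ⟨hi₁, hi⟩, rfl⟩
      exact ⟨⟨h.start ▸ hlt (by omega) (by omega), h.last ▸ hlt (by omega) le_rfl⟩,
        (h.axis (by omega)).1 (even_two_mul i)⟩
  have hinj : Set.InjOn (fun i => t (2 * i)) (Finset.Icc 1 n : Set ℕ) := fun i hi j hj hij => by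
    rw [Finset.coe_Icc, Set.mem_Icc] at hi hj
    have := hmono.injOn (Set.mem_Iic.2 (show 2 * i ≤ 2 * n + 1 by omega))
      (Set.mem_Iic.2 (show 2 * j ≤ 2 * n + 1 by omega)) hij
    omega
  rw [zeroCount, hset, hinj.encard_image, Set.encard_coe_eq_coe_finsetCard, Nat.card_Icc,
    Nat.add_sub_cancel]

end IsWindingSolution

/-! ### Spectral triples -/

section weights

variable {a b p P : ℝ} {w : ℝ → ℝ}

theorem exists_isWeight_eqOn (hP : 0 < P) (hpos : ∀ x ∈ Set.Icc a b, 0 < w x)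
    (hw : MemLp w (ENNReal.ofReal P) (volume.restrict (Set.Icc a b))) :
    ∃ W, IsWeight W ∧ Set.EqOn W (fun x => w x ^ P) (Set.Icc a b) := by
  classical
  refine ⟨(Set.Icc a b).piecewise (fun x => w x ^ P) 1, ⟨fun x => ?_, fun x y => ?_⟩,
    Set.piecewise_eqOn _ _ _⟩
  · by_cases hx : x ∈ Set.Icc a b
    · rw [Set.piecewise_eq_of_mem _ _ _ hx]
      exact Real.rpow_pos_of_pos (hpos x hx) P
    · rw [Set.piecewise_eq_of_notMem _ _ _ hx]
      exact one_pos
  · have hin : IntegrableOn (fun x => w x ^ P) (Set.Icc a b) := by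
      have hnorm := hw.integrable_norm_rpow (ENNReal.ofReal_pos.2 hP).ne' ENNReal.ofReal_ne_top
      rw [ENNReal.toReal_ofReal hP.le] at hnorm
      exact IntegrableOn.congr_fun hnorm
        (fun s hs => by simp only [Real.norm_of_nonneg (hpos s hs).le]) measurableSet_Icc
    have hout : IntervalIntegrable (1 : ℝ → ℝ) volume x y := intervalIntegrable_const
    have hcompl := measurableSet_Icc (a := a) (b := b).compl
    rw [← Set.indicator_add_compl_eq_piecewise]
    exact (hin.integrable_indicator measurableSet_Icc).intervalIntegrable.add
      ⟨hout.1.indicator hcompl, hout.2.indicator hcompl⟩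

theorem memLp_signedPow (h : p.HolderConjugate P) {α : Type*} {m : MeasurableSpace α}
    {μ : Measure α} {w : α → ℝ} (hw : MemLp w (ENNReal.ofReal P) μ) :
    MemLp (fun x => signedPow P (w x)) (ENNReal.ofReal p) μ := by
  rw [← integrable_norm_rpow_iff
    ((continuous_signedPow h.symm.lt).comp_aestronglyMeasurable hw.1)
    (ENNReal.ofReal_pos.2 h.pos).ne' ENNReal.ofReal_ne_top, ENNReal.toReal_ofReal h.nonneg]
  have hnorm := hw.integrable_norm_rpow (ENNReal.ofReal_pos.2 h.symm.pos).ne' ENNReal.ofReal_ne_top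
  rw [ENNReal.toReal_ofReal h.symm.nonneg] at hnorm
  refine hnorm.congr (.of_forall fun x => ?_)
  have hexp : (P - 1) * p = P := by linarith [h.mul_eq_add]
  simp only [Real.norm_eq_abs]
  rw [abs_signedPow, signedPow_of_nonneg h.symm.lt (abs_nonneg _), ← Real.rpow_mul (abs_nonneg _),
    hexp]

theorem memLp_mul_of_continuousOn {r : ENNReal} {g : ℝ → ℝ}
    (hw : MemLp w r (volume.restrict (Set.Icc a b))) (hg : ContinuousOn g (Set.Icc a b)) :
    MemLp (fun x => w x * g x) r (volume.restrict (Set.Icc a b)) := by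
  obtain ⟨C, hC⟩ := isCompact_Icc.exists_bound_of_continuousOn hg
  refine hw.of_le_mul (c := C) (hw.1.mul (hg.aestronglyMeasurable measurableSet_Icc)) ?_
  refine (ae_restrict_iff' measurableSet_Icc).2 (.of_forall fun x hx => ?_)
  rw [norm_mul, mul_comm]
  exact mul_le_mul_of_nonneg_right (hC x hx) (norm_nonneg _)

end weights

section operators

variable {a b p q : ℝ} {u v f g : ℝ → ℝ}

theorem hardyOp_smul (r : ℝ) (f : ℝ → ℝ) : hardyOp a u v (r • f) = r • hardyOp a u v f := by
  funext x
  simp only [hardyOp, Pi.smul_apply, smul_eq_mul, mul_assoc, intervalIntegral.integral_const_mul]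
  ring

theorem hardyDual_smul (r : ℝ) (h : ℝ → ℝ) : hardyDual b u v (r • h) = r • hardyDual b u v h := by
  funext x
  simp only [hardyDual, Pi.smul_apply, smul_eq_mul, mul_left_comm _ r,
    intervalIntegral.integral_const_mul]

theorem signedPow_comp_smul (r : ℝ) (g : ℝ → ℝ) :
    (fun y => signedPow q ((r • g) y)) = signedPow q r • fun y => signedPow q (g y) :=
  funext fun _ => signedPow_mul _ _ _

theorem eLpNorm_ne_zero_of_hardyOp_ne_zero {r : ENNReal} {x : ℝ} (hr : r ≠ 0)
    (hf : AEStronglyMeasurable f (volume.restrict (Set.Icc a b))) (hx : x ∈ Set.Icc a b)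
    (h : hardyOp a u v f x ≠ 0) : eLpNorm f r (volume.restrict (Set.Icc a b)) ≠ 0 := by
  rw [Ne, eLpNorm_eq_zero_iff hf hr, Filter.EventuallyEq, ae_restrict_iff' measurableSet_Icc]
  refine fun hae => h (mul_eq_zero_of_right _ (intervalIntegral.integral_zero_ae ?_))
  filter_upwards [hae] with s hs hsx
  rw [Set.uIoc_of_le hx.1] at hsx
  rw [hs ⟨hsx.1.le, hsx.2.trans hx.2⟩, Pi.zero_apply, zero_mul]

theorem exists_smul_mem_SP {c k : ℝ} (hk : k ≠ 0)
    (hf : MemLp f (ENNReal.ofReal p) (volume.restrict (Set.Icc a b)))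
    (hf₀ : eLpNorm f (ENNReal.ofReal p) (volume.restrict (Set.Icc a b)) ≠ 0)
    (hg : ∀ x ∈ Set.Icc a b, hardyOp a u v f x = k * g x)
    (hfg : ∀ x ∈ Set.Icc a b,
      signedPow p (f x) = c * hardyDual b u v (fun y => signedPow q (g y)) x) :
    ∃ r : ℝ, r ≠ 0 ∧ ∃ f' l, (r • g, f', l) ∈ SP a b p q u v := by
  obtain ⟨r, hr, hnorm⟩ : ∃ r : ℝ, 0 < r ∧
      eLpNorm (r • f) (ENNReal.ofReal p) (volume.restrict (Set.Icc a b)) = 1 := by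
    have hpos := ENNReal.toReal_pos hf₀ hf.2.ne
    refine ⟨_, inv_pos.2 hpos, ?_⟩
    rw [eLpNorm_const_smul, Real.enorm_of_nonneg (inv_pos.2 hpos).le,
      ENNReal.ofReal_inv_of_pos hpos, ENNReal.ofReal_toReal hf.2.ne,
      ENNReal.inv_mul_cancel hf₀ hf.2.ne]
  have hrk : r * k ≠ 0 := mul_ne_zero hr.ne' hk
  refine ⟨r * k, hrk, r • f, signedPow p r * c / signedPow q (r * k), hf.const_smul r, hnorm,
    fun x hx => ?_, fun x hx => ?_⟩
  · simp only [hardyOp_smul, Pi.smul_apply, smul_eq_mul, hg x hx, mul_assoc]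
  · have hq : signedPow q (r * k) ≠ 0 := signedPow_ne_zero hrk
    rw [signedPow_comp_smul, hardyDual_smul]
    simp only [Pi.smul_apply, smul_eq_mul, signedPow_mul p, hfg x hx]
    field_simp

theorem zeroCount_congr (h : ∀ x ∈ Set.Ioo a b, f x = 0 ↔ g x = 0) :
    zeroCount a b f = zeroCount a b g :=
  congrArg Set.encard (Set.ext fun x => and_congr_right (h x))

end operators

theorem signedPow_mul_mul (P s : ℝ) {t : ℝ} (ht : 0 < t) :
    signedPow P (t * s) * t = signedPow P s * t ^ P := by
  have hpow : t ^ (P - 1) * t = t ^ P := by rw [← Real.rpow_add_one ht.ne', sub_add_cancel]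
  rw [signedPow_mul, signedPow_of_pos P ht, ← hpow]
  ring

namespace IsSolutionOn

variable {P Q a b c₁ c₂ x : ℝ} {U V u v f g : ℝ → ℝ}

theorem hardyOp_signedPow (h : IsSolutionOn P Q U V c₁ c₂ f g (Set.Icc a b)) (hf : f a = 0)
    (hc₁ : c₁ ≠ 0) (hu : ∀ s ∈ Set.Icc a b, 0 < u s)
    (hU : Set.EqOn U (fun s => u s ^ P) (Set.Icc a b)) (hx : x ∈ Set.Icc a b) :
    hardyOp a u v (fun s => signedPow P (u s * g s)) x = c₁⁻¹ * (v x * f x) := by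
  have hint : ∫ s in a..x, signedPow P (u s * g s) * u s = ∫ s in a..x, signedPow P (g s) * U s :=
    intervalIntegral.integral_congr fun s hs => by
      rw [Set.uIcc_of_le hx.1] at hs
      have hs' : s ∈ Set.Icc a b := ⟨hs.1, hs.2.trans hx.2⟩
      simp only [signedPow_mul_mul P (g s) (hu s hs'), hU hs']
  have hsub := h.fst_sub a (Set.left_mem_Icc.2 (hx.1.trans hx.2)) x hx
  rw [hf, sub_zero] at hsub
  rw [hardyOp, hint, hsub]
  field_simp

theorem hardyDual_signedPow (h : IsSolutionOn P Q U V c₁ c₂ f g (Set.Icc a b)) (hg : g b = 0)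
    (hc₂ : c₂ ≠ 0) (hv : ∀ s ∈ Set.Icc a b, 0 < v s)
    (hV : Set.EqOn V (fun s => v s ^ Q) (Set.Icc a b)) (hx : x ∈ Set.Icc a b) :
    hardyDual b u v (fun s => signedPow Q (v s * f s)) x = c₂⁻¹ * (u x * g x) := by
  have hint : ∫ s in x..b, v s * signedPow Q (v s * f s) = ∫ s in x..b, signedPow Q (f s) * V s :=
    intervalIntegral.integral_congr fun s hs => by
      rw [Set.uIcc_of_le hx.2] at hs
      have hs' : s ∈ Set.Icc a b := ⟨hx.1.trans hs.1, hs.2⟩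
      simp only [mul_comm (v s), ← signedPow_mul_mul Q (f s) (hv s hs'), hV hs']
  have hsub := h.snd_sub x hx b (Set.right_mem_Icc.2 (hx.1.trans hx.2))
  rw [hg, sub_zero] at hsub
  rw [hardyDual, hint, hsub]
  field_simp

end IsSolutionOn

theorem IsWindingSolution.exists_smul_mem_SP {a b p q P c₁ c₂ : ℝ} {U V u v f g : ℝ → ℝ} {n : ℕ}
    {t : ℕ → ℝ} (h : IsWindingSolution P q a b U V n c₁ c₂ f g t) (hP : p.HolderConjugate P)
    (hu_pos : ∀ x ∈ Set.Icc a b, 0 < u x) (hv_pos : ∀ x ∈ Set.Icc a b, 0 < v x)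
    (hu : MemLp u (ENNReal.ofReal P) (volume.restrict (Set.Icc a b)))
    (hU : Set.EqOn U (fun x => u x ^ P) (Set.Icc a b))
    (hV : Set.EqOn V (fun x => v x ^ q) (Set.Icc a b)) :
    ∃ r : ℝ, r ≠ 0 ∧ ∃ f' l, (r • fun x => v x * f x, f', l) ∈ SP a b p q u v := by
  have hsol := h.isSolutionOn
  have hT : ∀ x ∈ Set.Icc a b,
      hardyOp a u v (fun s => signedPow P (u s * g s)) x = c₁⁻¹ * (v x * f x) := fun x =>
    hsol.hardyOp_signedPow h.fst_left h.fst_coeff_ne_zero hu_pos hU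
  have hc₁ : c₁⁻¹ ≠ 0 := inv_ne_zero h.fst_coeff_ne_zero
  have hmem := memLp_signedPow hP (memLp_mul_of_continuousOn hu hsol.continuous_snd.continuousOn)
  obtain ⟨x, hx, hfx, -⟩ := h.exists_ne_zero
  have hne := eLpNorm_ne_zero_of_hardyOp_ne_zero (ENNReal.ofReal_pos.2 hP.pos).ne' hmem.1 hx
    ((hT x hx).trans_ne (mul_ne_zero hc₁ (mul_ne_zero (hv_pos x hx).ne' hfx)))
  refine HardySystem.exists_smul_mem_SP (c := c₂) hc₁ hmem hne hT fun x hx => ?_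
  rw [hsol.hardyDual_signedPow h.snd_right h.snd_coeff_ne_zero hv_pos hV hx,
    signedPow_signedPow_conj hP, mul_inv_cancel_left₀ h.snd_coeff_ne_zero]

end HardySystem

theorem theorem2p2 (a b p q : ℝ) (hab : a < b) (hp : 1 < p) (hq : 1 < q) (u v : ℝ → ℝ)
    (hu_pos : ∀ x ∈ Set.Icc a b, 0 < u x) (hv_pos : ∀ x ∈ Set.Icc a b, 0 < v x)
    (hu : MemLp u (ENNReal.ofReal p.conjExponent) (volume.restrict (Set.Icc a b)))
    (hv : MemLp v (ENNReal.ofReal q) (volume.restrict (Set.Icc a b))) (n : ℕ) :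
    (HardySystem.SPn a b p q u v n).Nonempty := by
  have hconj := Real.HolderConjugate.conjExponent hp
  obtain ⟨U, hU, hUu⟩ := HardySystem.exists_isWeight_eqOn hconj.symm.pos hu_pos hu
  obtain ⟨V, hV, hVv⟩ := HardySystem.exists_isWeight_eqOn (zero_lt_one.trans hq) hv_pos hv
  obtain ⟨c₁, c₂, f, g, t, h⟩ :=
    HardySystem.exists_isWindingSolution hconj.symm.lt hq hab hU hV n
  obtain ⟨r, hr, f', l, hmem⟩ := h.exists_smul_mem_SP hconj hu_pos hv_pos hu hUu hVv
  have hzero : HardySystem.zeroCount a b (r • fun x => v x * f x) =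
      HardySystem.zeroCount a b f :=
    HardySystem.zeroCount_congr fun x hx => by
      simp [hr, (hv_pos x (Set.Ioo_subset_Icc_self hx)).ne']
  exact ⟨_, hmem, hzero.trans (h.zeroCount_fst hconj.symm.lt hq hU hV)⟩
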